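/- Let $\mathbb T=\mathbb R/\mathbb Z$, let $\alpha\in\mathbb R\setminus\mathbb Q$ have continued fraction convergents $p_n/q_n$, and put $\beta(\alpha)=\limsup_{n\to\infty}\frac{\ln q_{n+1}}{q_n}\in[0,\infty]$. Let $m\ge 1$ and $\theta_1,\dots,\theta_m\in\mathbb T$. Then there is a set $\Theta\subset\mathbb T$ of full Lebesgue measure, depending only on $\alpha,\theta_1,\dots,\theta_m$, with $\theta+k\alpha\neq\theta_\ell$ for all $\theta\in\Theta$, $k\in\mathbb Z$, $1\le \ell\le m$, such that the following holds. Let $\tau_0,\tau_1,\dots,\tau_m\in(0,1]$, $\tau_{\min}=\min_{0\le\ell\le m}\tau_\ell$, and let $f,g:\mathbb T\to\mathbb R$ be $\tau_0$-Hölder continuous, with $$f(x)=\widetilde f(x)\prod_{\ell=1}^m|\sin\pi(x-\theta_\ell)|^{\tau_\ell},\qquad \widetilde f\in C^0(\mathbb T,\mathbb R),\quad \inf_{\mathbb T}|\widetilde f|>0 .$$ For $E\in\mathbb R$ let $$A(x)=A^E(x)=\begin{pmatrix}E-\frac{g(x)}{f(x)}&-1\\1&0\end{pmatrix},\qquad A_r(x)=A(x+(r-1)\alpha)\cdots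 A(x+\alpha)A(x),\qquad L(E)=\lim_{n\to\infty}\frac1n\int_{\mathbb T}\ln\|A_n(x)\|\,dx ,$$ where $\|\cdot\|$ is the Euclidean operator norm. The functions $\ln\|A_n\|$ are integrable, the limit $L(E)$ exists, and $L$ is bounded above on compact sets. Let $b\in\mathbb R$ with $b\le\beta(\alpha)$ (so $b=\beta(\alpha)$ is allowed if $\beta(\alpha)<\infty$), and let $\varepsilon>0$ be small enough that $\frac{\varepsilon}{10}\tau_{\min}<\tau_{\min}b-\frac{\varepsilon}{4}$. Let $\mathcal N$ be the set of all $n$ with $$\frac{\tau_{\min}\ln q_{n+1}}{q_n}>\tau_{\min}b-\frac{\varepsilon}{4}.$$ Then $\mathcal N$ is infinite, and: 1. For every $\theta\in\Theta$ and $E\in\mathbb R$, for all sufficiently large $n\in\mathcal N$ and all integers $1\le r\le q_n$, $$\sup_{k\in\mathbb Z,\ |k|\le e^{\varepsilon q_n/10}}\|A_r(\theta+k\alpha)\|<e^{(L(E)+2\varepsilon)q_n}.$$ 2. For every $\theta\in\Theta$ and every compact $I\subset\mathbb R$, with $\Lambda=2\varepsilon+\sup_{E\in I}L(E)$, for all sufficiently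 large $n\in\mathcal N$ (with a threshold that does not depend on $E$), all $E\in I$ and all integers $1\le r\le q_n$, $$\sup_{k\in\mathbb Z,\ |k|\le e^{\varepsilon q_n/10}}\|A^E_r(\theta+k\alpha)\|<e^{\Lambda q_n}.$$ -/

import Mathlib

open Filter Topology MeasureTheory
open scoped NNReal Matrix.Norms.L2Operator

noncomputable section

namespace UnboundedCocycle

/-- The denominator `q_n` of the `n`-th continued fraction convergent `p_n / q_n` of `α`. -/
def cfDen (α : ℝ) (n : ℕ) : ℝ := (GenContFract.of α).dens n

/-- `β(α) = limsup_n (ln q_{n+1}) / q_n`, with values in the extended reals. -/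
def betaIndex (α : ℝ) : EReal :=
  limsup (fun n : ℕ => ((Real.log (cfDen α (n + 1)) / cfDen α n : ℝ) : EReal)) atTop

theorem periodic_abs_sin_pi : Function.Periodic (fun x : ℝ => |Real.sin (Real.pi * x)|) 1 := by
  intro x
  simp [mul_add, Real.sin_add_pi]

/-- The function `x ↦ |sin (π x)|` on the circle `ℝ / ℤ`. -/
def absSinPi : UnitAddCircle → ℝ := periodic_abs_sin_pi.lift

@[simp]
theorem absSinPi_coe (x : ℝ) : absSinPi (x : UnitAddCircle) = |Real.sin (Real.pi * x)| := rfl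

/-- `f = F · ∏_ℓ |sin π(· - ζ_ℓ)|^{σ_ℓ}` on the circle, where `F` is continuous and `|F|` is
bounded away from zero. -/
def HasZeroFactorization {m : ℕ} (ζ : Fin m → UnitAddCircle) (σ : Fin m → ℝ≥0)
    (f : UnitAddCircle → ℝ) : Prop :=
  ∃ F : UnitAddCircle → ℝ, Continuous F ∧ (∃ c : ℝ, 0 < c ∧ ∀ x, c ≤ |F x|) ∧
    ∀ x, f x = F x * ∏ ℓ : Fin m, absSinPi (x - ζ ℓ) ^ (σ ℓ : ℝ)

/-- The minimum of `τ_0, …, τ_m`. -/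
def tauMin {m : ℕ} (τ : Fin (m + 1) → ℝ≥0) : ℝ :=
  (Finset.univ.inf' Finset.univ_nonempty τ : ℝ≥0)

/-- The transfer matrix of the potential `g / f` at energy `E` and phase `x`. -/
def transferMatrix (f g : UnitAddCircle → ℝ) (E : ℝ) (x : UnitAddCircle) :
    Matrix (Fin 2) (Fin 2) ℝ :=
  !![E - g x / f x, -1; 1, 0]

/-- The iterates of a cocycle over the rotation by `α`:
`M_n(x) = M(x + (n-1)α) ⋯ M(x + α) M(x)`. -/
def iterate (α : ℝ) (M : UnitAddCircle → Matrix (Fin 2) (Fin 2) ℝ) :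
    ℕ → UnitAddCircle → Matrix (Fin 2) (Fin 2) ℝ
  | 0, _ => 1
  | n + 1, x => M (x + n • (α : UnitAddCircle)) * iterate α M n x

/-- The averages `(1/n) ∫ ln ‖M_n(x)‖ dx` over the circle of total length one. -/
def lyapunovAverage (α : ℝ) (M : UnitAddCircle → Matrix (Fin 2) (Fin 2) ℝ) (n : ℕ) : ℝ :=
  (1 / (n : ℝ)) * ∫ x : UnitAddCircle, Real.log ‖iterate α M n x‖

/-- The Lyapunov exponent `L(α, M) = lim_n (1/n) ∫ ln ‖M_n(x)‖ dx`. -/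
def lyapunov (α : ℝ) (M : UnitAddCircle → Matrix (Fin 2) (Fin 2) ℝ) : ℝ :=
  limUnder atTop (lyapunovAverage α M)

/-- The index `n` belongs to the subsequence of resonant denominators:
`τ ln q_{n+1} / q_n > τ b - ε / 4`. -/
def IsResonant (α τ b ε : ℝ) (n : ℕ) : Prop :=
  τ * b - ε / 4 < τ * Real.log (cfDen α (n + 1)) / cfDen α n

end UnboundedCocycle

end

noncomputable section

namespace UnboundedCocycle

/-! Clearing the denominator of the potential turns `A^E` into the continuous matrix `D^E = f ·
A^E`, and off the zeros of `f`, `ln ‖A_r‖ = ln ‖D_r‖ - ∑ ln |f|` along the orbit. So an upper bound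
for a continuous cocycle and a lower bound for a Birkhoff sum with logarithmic singularities
suffice. Put `c = ∫ ln |f|`.

Upper bound (`exists_norm_iterate_clearedMatrix_le`): by unique ergodicity and subadditivity, `ln
‖D_r‖ ≤ r (L(E₀) + c + ε/2) + B`, uniformly in the phase and in all energies near `E₀`.

Lower bound (`HasZeroFactorization.exists_sum_log_abs_ge`): cut the singularities off at a small
level `η` and apply unique ergodicity to the continuous remainder. What was cut off is controlled
for `r ≤ q_n`, because the orbit points are `1 / (2 q_n)`-separated: it costs a small multiple of
`q_n` plus the logarithm of the distance to the nearest zero.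

Resonance (`eventually_le_abs_of_isResonant`): for `n ∈ 𝒩` the next denominator exceeds `e^{ε q_n /
10}` by an exponential factor, so over the whole window of `k` the rotation is almost the rational
one by `p_n / q_n`. By Borel–Cantelli a typical `θ` satisfies `‖q (θ - ζ_ℓ)‖ ≥ 1 / q²` for large
`q`, so the orbit stays `1 / (2 q_n³)` away from the zeros. The logarithmic cost is then `O(ln q_n)
= o(q_n)`.

The bounds combine near each energy, since `L ≥ 0` permits replacing `r` by `q_n`; compactness
yields uniformity on `I`. -/

/-! ### Continued fractions and small divisors -/

theorem not_terminatedAt_of_irrational {α : ℝ} (hα : Irrational α) (n : ℕ) :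
    ¬(GenContFract.of α).TerminatedAt n := fun h => by
  obtain ⟨q, hq⟩ := (GenContFract.terminates_iff_rat α).1 ⟨n, h⟩
  exact hα ⟨q, hq.symm⟩

/-- Integrality propagates through the recurrence because partial numerators are 1 and partial
denominators are integers; after termination the sequence is constant. -/
theorem exists_int_contsAux (α : ℝ) (n : ℕ) :
    ∃ a b : ℤ, (GenContFract.of α).contsAux n = ⟨(a : ℝ), (b : ℝ)⟩ := by
  induction n using Nat.strong_induction_on with
  | _ n ih =>
    match n with
    | 0 => exact ⟨1, 0, by simp [GenContFract.contsAux]⟩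
    | 1 => exact ⟨⌊α⌋, 1, by simp [GenContFract.contsAux, GenContFract.of_h_eq_floor]⟩
    | n + 2 =>
      obtain ⟨a, b, hab⟩ := ih n (by omega)
      obtain ⟨a', b', hab'⟩ := ih (n + 1) (by omega)
      cases hs : (GenContFract.of α).s.get? n with
      | none => exact ⟨a', b', by simpa [GenContFract.contsAux, hs] using hab'⟩
      | some gp =>
        obtain ⟨h1, z, h2⟩ := GenContFract.of_partNum_eq_one_and_exists_int_partDen_eq hs
        refine ⟨z * a' + a, z * b' + b, ?_⟩
        rw [GenContFract.contsAux_recurrence hs hab hab', h1, h2]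
        simp

theorem exists_int_nums_dens (α : ℝ) (n : ℕ) :
    ∃ a b : ℤ, (GenContFract.of α).nums n = a ∧ (GenContFract.of α).dens n = b := by
  obtain ⟨a, b, h⟩ := exists_int_contsAux α (n + 1)
  refine ⟨a, b, ?_, ?_⟩
  · rw [GenContFract.num_eq_conts_a, GenContFract.nth_cont_eq_succ_nth_contAux, h]
  · rw [GenContFract.den_eq_conts_b, GenContFract.nth_cont_eq_succ_nth_contAux, h]

theorem fib_le_cfDen {α : ℝ} (hα : Irrational α) (n : ℕ) : (Nat.fib (n + 1) : ℝ) ≤ cfDen α n :=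
  GenContFract.succ_nth_fib_le_of_nth_den (.inr (not_terminatedAt_of_irrational hα _))

theorem cfDen_pos {α : ℝ} (hα : Irrational α) (n : ℕ) : 0 < cfDen α n :=
  lt_of_lt_of_le (by exact_mod_cast Nat.fib_pos.2 n.succ_pos) (fib_le_cfDen hα n)

theorem tendsto_cfDen {α : ℝ} (hα : Irrational α) : Tendsto (cfDen α) atTop atTop := by
  have h : Tendsto (fun n : ℕ => (n : ℝ) + -1) atTop atTop :=
    tendsto_atTop_add_const_right _ _ tendsto_natCast_atTop_atTop
  refine tendsto_atTop_mono (fun n => ?_) h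
  have h1 := fib_le_cfDen hα n
  have h2 : n + 1 ≤ Nat.fib (n + 1) + 1 := Nat.le_fib_add_one _
  have h3 : ((n + 1 : ℕ) : ℝ) ≤ ((Nat.fib (n + 1) + 1 : ℕ) : ℝ) := by exact_mod_cast h2
  push_cast at h3
  linarith

/-- The determinant identity for consecutive convergents is a Bézout relation, hence coprimality;
multiplying the classical error bound by the denominator gives the estimate. -/
theorem exists_convergent {α : ℝ} (hα : Irrational α) (n : ℕ) :
    ∃ (q : ℕ) (p : ℤ), cfDen α n = q ∧ 0 < q ∧ IsCoprime p (q : ℤ) ∧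
      |q * α - p| ≤ 1 / cfDen α (n + 1) := by
  obtain ⟨a, b, ha, hb⟩ := exists_int_nums_dens α n
  obtain ⟨a', b', ha', hb'⟩ := exists_int_nums_dens α (n + 1)
  have hpos := cfDen_pos hα n
  have hpos' := cfDen_pos hα (n + 1)
  have hnt := not_terminatedAt_of_irrational hα n
  have hb0 : 0 < b := by
    have : (0 : ℝ) < b := hb ▸ hpos
    exact_mod_cast this
  lift b to ℕ using hb0.le
  have hdet := SimpContFract.determinant (s := ⟨GenContFract.of α, GenContFract.of_isSimpContFract α⟩) hnt
  change (GenContFract.of α).nums n * (GenContFract.of α).dens (n + 1) -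
    (GenContFract.of α).dens n * (GenContFract.of α).nums (n + 1) = (-1) ^ (n + 1) at hdet
  rw [ha, hb, ha', hb'] at hdet
  have hdet' : a * b' - b * a' = (-1) ^ (n + 1) := by exact_mod_cast hdet
  refine ⟨b, a, by simpa [cfDen] using hb, by exact_mod_cast hb0, ?_, ?_⟩
  · refine ⟨(-1) ^ (n + 1) * b', -((-1) ^ (n + 1) * a'), ?_⟩
    calc (-1) ^ (n + 1) * b' * a + -((-1) ^ (n + 1) * a') * b
        = (-1) ^ (n + 1) * (a * b' - b * a') := by ring
      _ = 1 := by rw [hdet', ← pow_add, ← two_mul, pow_mul]; simp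
  · have h := GenContFract.abs_sub_convs_le (v := α) hnt
    rw [GenContFract.conv_eq_num_div_den, ha] at h
    change |α - a / cfDen α n| ≤ 1 / (cfDen α n * cfDen α (n + 1)) at h
    have hq : cfDen α n = (b : ℝ) := by simpa [cfDen] using hb
    rw [hq] at h hpos
    calc |b * α - a| = b * |α - a / b| := by
          rw [← abs_of_pos hpos, ← abs_mul, abs_of_pos hpos, mul_sub, mul_div_cancel₀ _ hpos.ne']
      _ ≤ b * (1 / (b * cfDen α (n + 1))) := by gcongr
      _ = 1 / cfDen α (n + 1) := by field_simp

/-- Distinct points `kα` with `|k| < q` are `1 / (2q)`-separated modulo one when `α` is very close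
to a reduced fraction with denominator `q`. -/
theorem le_abs_int_mul_sub {α Q : ℝ} {q : ℕ} {p : ℤ} (hq : 0 < q) (hpq : IsCoprime p (q : ℤ))
    (hQ : 2 * q ≤ Q) (h : |q * α - p| ≤ 1 / Q) {k : ℤ} (hk0 : k ≠ 0) (hk : |k| < q) (l : ℤ) :
    1 / (2 * q) ≤ |k * α - l| := by
  have hq' : (0 : ℝ) < q := by exact_mod_cast hq
  have hQ0 : 0 < Q := by linarith
  -- A reduced denominator `q` cannot divide `k * p` when `0 < |k| < q`. This nonzero integer has
  -- modulus at least 1, and replacing `p / q` by `α` moves it by at most `q / Q ≤ 1 / 2`.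
  have hne : k * p - q * l ≠ 0 := by
    intro h0
    have hd : (q : ℤ) ∣ k := hpq.symm.dvd_of_dvd_mul_right ⟨l, by linarith⟩
    have := Int.le_of_dvd (abs_pos.2 hk0) ((dvd_abs _ _).2 hd)
    omega
  have h1 : (1 : ℝ) ≤ |(k : ℝ) * p - q * l| := by
    have := Int.one_le_abs hne
    exact_mod_cast this
  have hk' : |(k : ℝ)| ≤ q := by exact_mod_cast hk.le
  have h2 : |(k : ℝ) * (q * α - p)| ≤ 1 / 2 := by
    rw [abs_mul]
    calc |(k : ℝ)| * |q * α - p| ≤ q * (1 / Q) := by gcongr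
      _ ≤ 1 / 2 := by rw [mul_one_div, div_le_iff₀ hQ0]; linarith
  have h3 : (q : ℝ) * (k * α - l) = (k * p - q * l) + k * (q * α - p) := by ring
  have h4 : (q : ℝ) * |k * α - l| = |(k * p - q * l) + k * (q * α - p)| := by
    rw [← h3, abs_mul, abs_of_pos hq']
  have h5 := abs_sub_abs_le_abs_sub ((k : ℝ) * p - q * l) (-(k * (q * α - p)))
  rw [abs_neg, sub_neg_eq_add] at h5
  rw [div_le_iff₀ (by positivity)]
  nlinarith

/-- Multiplied by `q`, the quantity becomes `q * t` plus an integer plus `k * (q * α - p)`. The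
integer is invisible on the circle and the last term is at most half of the lower bound on `‖q t‖`;
dividing by `q` produces the cube. -/
theorem le_abs_add_int_mul_sub {α Q t : ℝ} {q : ℕ} {p : ℤ} (hq : 0 < q) (hQ : 0 < Q)
    (h : |q * α - p| ≤ 1 / Q) (ht : 1 / (q : ℝ) ^ 2 ≤ ‖((q * t : ℝ) : UnitAddCircle)‖) {k : ℤ}
    (hk : 2 * (q : ℝ) ^ 2 * |(k : ℝ)| ≤ Q) (l : ℤ) :
    1 / (2 * (q : ℝ) ^ 3) ≤ |t + k * α - l| := by
  have hq' : (0 : ℝ) < q := by exact_mod_cast hq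
  have h1 : 1 / (q : ℝ) ^ 2 ≤ |q * t + (k * p - q * l)| := by
    refine ht.trans ?_
    have : ((q * t : ℝ) : UnitAddCircle) = ((q * t + (k * p - q * l : ℤ) : ℝ) : UnitAddCircle) := by
      have h0 : (((k * p - q * l : ℤ) : ℝ) : UnitAddCircle) = 0 :=
        (AddCircle.coe_eq_zero_iff 1).2 ⟨k * p - q * l, by simp⟩
      rw [AddCircle.coe_add, h0, add_zero]
    rw [this]
    refine (QuotientAddGroup.norm_mk_le_norm).trans ?_
    rw [Real.norm_eq_abs]
    push_cast
    exact le_rfl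
  have h2 : |(k : ℝ) * (q * α - p)| ≤ 1 / (2 * (q : ℝ) ^ 2) := by
    rw [abs_mul]
    calc |(k : ℝ)| * |q * α - p| ≤ |(k : ℝ)| * (1 / Q) := by gcongr
      _ ≤ 1 / (2 * (q : ℝ) ^ 2) := by
        rw [mul_one_div, div_le_div_iff₀ hQ (by positivity)]; linarith
  have h4 : (q : ℝ) * |t + k * α - l| = |(q * t + (k * p - q * l)) + k * (q * α - p)| := by
    rw [← abs_of_pos hq', ← abs_mul, abs_of_pos hq']
    congr 1; ring
  have h5 := abs_sub_abs_le_abs_sub ((q : ℝ) * t + (k * p - q * l)) (-(k * (q * α - p)))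
  rw [abs_neg, sub_neg_eq_add, ← h4] at h5
  have h6 : 1 / (q : ℝ) ^ 2 = 2 * (1 / (2 * (q : ℝ) ^ 2)) := by field_simp
  have h7 : 1 / (2 * (q : ℝ) ^ 2) ≤ q * |t + k * α - l| := by linarith
  have h8 : 1 / (2 * (q : ℝ) ^ 3) = 1 / (2 * (q : ℝ) ^ 2) / q := by field_simp
  rw [h8, div_le_iff₀ hq']
  linarith

/-! ### Unique ergodicity of irrational rotations -/

instance : IsProbabilityMeasure (volume : Measure UnitAddCircle) :=
  ⟨UnitAddCircle.measure_univ⟩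

/-- The continuous functions whose Birkhoff sums over the rotation by `a` grow uniformly like
`r ∫ φ`. -/
def uniformBirkhoff (a : UnitAddCircle) : Submodule ℂ C(UnitAddCircle, ℂ) where
  carrier := {φ | ∀ ε : ℝ, 0 < ε → ∃ B : ℝ, ∀ (r : ℕ) (x : UnitAddCircle),
    ‖∑ j ∈ Finset.range r, φ (x + j • a) - r * ∫ y : UnitAddCircle, φ y‖ ≤ ε * r + B}
  zero_mem' := fun ε hε => ⟨0, fun r x => by simp; positivity⟩
  add_mem' := by
    intro φ ψ hφ hψ ε hε
    obtain ⟨B, hB⟩ := hφ (ε / 2) (by positivity)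
    obtain ⟨B', hB'⟩ := hψ (ε / 2) (by positivity)
    refine ⟨B + B', fun r x => ?_⟩
    have hi : ∫ y : UnitAddCircle, (φ + ψ) y = (∫ y, φ y) + ∫ y, ψ y :=
      integral_add (φ.continuous.integrable_of_hasCompactSupport (.of_compactSpace _))
        (ψ.continuous.integrable_of_hasCompactSupport (.of_compactSpace _))
    calc _ = ‖(∑ j ∈ Finset.range r, φ (x + j • a) - r * ∫ y : UnitAddCircle, φ y) +
          (∑ j ∈ Finset.range r, ψ (x + j • a) - r * ∫ y : UnitAddCircle, ψ y)‖ := by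
          rw [hi]; simp only [ContinuousMap.add_apply, Finset.sum_add_distrib]; congr 1; ring
      _ ≤ _ := norm_add_le _ _
      _ ≤ _ := add_le_add (hB r x) (hB' r x)
      _ = _ := by ring
  smul_mem' := by
    intro c φ hφ ε hε
    obtain ⟨B, hB⟩ := hφ (ε / (‖c‖ + 1)) (by positivity)
    refine ⟨‖c‖ * B, fun r x => ?_⟩
    have hi : ∫ y : UnitAddCircle, (c • φ) y = c * ∫ y, φ y := integral_const_mul _ _
    calc _ = ‖c‖ * ‖∑ j ∈ Finset.range r, φ (x + j • a) - r * ∫ y : UnitAddCircle, φ y‖ := by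
          rw [hi, ← norm_mul, mul_sub, Finset.mul_sum]
          simp only [ContinuousMap.smul_apply, smul_eq_mul]; congr 1; ring
      _ ≤ ‖c‖ * (ε / (‖c‖ + 1) * r + B) := by gcongr; exact hB r x
      _ = ε * r * (‖c‖ / (‖c‖ + 1)) + ‖c‖ * B := by ring
      _ ≤ ε * r * 1 + ‖c‖ * B := by
          gcongr
          rw [div_le_one (by positivity)]; linarith
      _ = _ := by ring

/-- An approximant within `ε / 4` changes the sum and `r` times the integral by at most `r * ε / 4`
each, so its own constant `B` for `ε / 2` still works. -/
theorem isClosed_uniformBirkhoff (a : UnitAddCircle) :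
    IsClosed (uniformBirkhoff a : Set C(UnitAddCircle, ℂ)) := by
  refine isClosed_of_closure_subset fun φ hφ ε hε => ?_
  obtain ⟨ψ, hψ, hd⟩ := Metric.mem_closure_iff.1 hφ (ε / 4) (by positivity)
  obtain ⟨B, hB⟩ := hψ (ε / 2) (by positivity)
  have hpt : ∀ y, ‖φ y - ψ y‖ ≤ ε / 4 := fun y => by
    rw [← dist_eq_norm]; exact (ContinuousMap.dist_apply_le_dist y).trans hd.le
  refine ⟨B, fun r x => ?_⟩
  have h1 : ‖∑ j ∈ Finset.range r, (φ (x + j • a) - ψ (x + j • a))‖ ≤ r * (ε / 4) := by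
    refine (norm_sum_le_of_le _ fun j _ => hpt _).trans ?_
    simp
  have hi : ∫ y : UnitAddCircle, (φ y - ψ y) = (∫ y, φ y) - ∫ y, ψ y :=
    integral_sub (φ.continuous.integrable_of_hasCompactSupport (.of_compactSpace _))
        (ψ.continuous.integrable_of_hasCompactSupport (.of_compactSpace _))
  have h2 : ‖∫ y : UnitAddCircle, (φ y - ψ y)‖ ≤ ε / 4 := by
    refine (norm_integral_le_of_norm_le_const (C := ε / 4) (.of_forall hpt)).trans ?_
    simp
  calc _ = ‖(∑ j ∈ Finset.range r, ψ (x + j • a) - r * ∫ y : UnitAddCircle, ψ y) +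
          ∑ j ∈ Finset.range r, (φ (x + j • a) - ψ (x + j • a)) -
          r * ∫ y : UnitAddCircle, (φ y - ψ y)‖ := by
          rw [hi, Finset.sum_sub_distrib]; congr 1; ring
    _ ≤ (ε / 2 * r + B) + r * (ε / 4) + r * (ε / 4) := by
        refine (norm_sub_le _ _).trans (add_le_add ((norm_add_le _ _).trans
          (add_le_add (hB r x) h1)) ?_)
        rw [norm_mul, Complex.norm_natCast]
        gcongr
    _ = _ := by ring

theorem fourier_ne_one_of_irrational {a : ℝ} (ha : Irrational a) {n : ℤ} (hn : n ≠ 0) :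
    fourier n (a : UnitAddCircle) ≠ 1 := by
  rw [fourier_coe_apply]
  intro h
  obtain ⟨k, hk⟩ := Complex.exp_eq_one_iff.1 h
  have h2 : (2 * Real.pi * Complex.I : ℂ) ≠ 0 := Complex.two_pi_I_ne_zero
  have h3 : (n : ℂ) * a = k := by
    apply mul_left_cancel₀ h2
    push_cast at hk
    linear_combination hk
  have h4 : (n : ℝ) * a = k := by exact_mod_cast h3
  exact (ha.intCast_mul hn).ne_int k h4

/-- For a nontrivial character the Birkhoff sum is geometric with ratio `w ≠ 1`, hence bounded by `2
/ ‖1 - w‖` for every length. -/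
theorem fourier_mem_uniformBirkhoff {a : ℝ} (ha : Irrational a) (n : ℤ) :
    fourier n ∈ uniformBirkhoff (a : UnitAddCircle) := by
  intro ε hε
  rcases eq_or_ne n 0 with rfl | hn
  · refine ⟨0, fun r x => ?_⟩
    simp
    positivity
  -- Translation by `1 / (2n)` changes the sign of the character, so its integral equals its own
  -- negative.
  have hint : ∫ y : UnitAddCircle, fourier n y = 0 := by
    have h := integral_add_right_eq_self (μ := (volume : Measure UnitAddCircle))
      (fun y => fourier n y) ((1 / 2 / n : ℝ) : UnitAddCircle)
    simp only [fourier_add_half_inv_index hn one_pos, integral_neg] at h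
    exact self_eq_neg.1 h.symm
  set w := fourier n (a : UnitAddCircle) with hw
  have hw1 : w ≠ 1 := fourier_ne_one_of_irrational ha hn
  have hw0 : 0 < ‖1 - w‖ := norm_pos_iff.2 (sub_ne_zero.2 hw1.symm)
  have hnorm : ∀ y : UnitAddCircle, ‖fourier n y‖ = 1 := fun y => by
    rw [fourier_apply]; exact Circle.norm_coe _
  refine ⟨2 / ‖1 - w‖, fun r x => ?_⟩
  have hmul : ∀ j : ℕ, fourier n (x + j • (a : UnitAddCircle)) = fourier n x * w ^ j := by
    intro j
    induction j with
    | zero => simp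
    | succ j ih =>
      rw [succ_nsmul, ← add_assoc, pow_succ, ← mul_assoc, ← ih, hw]
      simp only [fourier_apply, smul_add, AddCircle.toCircle_add, Circle.coe_mul]
  rw [hint, mul_zero, sub_zero]
  simp only [hmul, ← Finset.mul_sum]
  rw [norm_mul, hnorm, one_mul]
  have hg := congrArg norm (mul_neg_geom_sum w r)
  rw [norm_mul] at hg
  have h2 : ‖1 - w ^ r‖ ≤ 2 := by
    refine (norm_sub_le _ _).trans ?_
    rw [norm_pow, hw, hnorm]; norm_num
  have h3 : ‖∑ i ∈ Finset.range r, w ^ i‖ ≤ 2 / ‖1 - w‖ := by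
    rw [le_div_iff₀ hw0, mul_comm, hg]; exact h2
  have : 0 ≤ ε * r := by positivity
  linarith

/-- Unique ergodicity of an irrational rotation, as a uniform bound on Birkhoff sums. -/
theorem exists_birkhoff_bound {a : ℝ} (ha : Irrational a) {φ : UnitAddCircle → ℝ}
    (hφ : Continuous φ) {ε : ℝ} (hε : 0 < ε) :
    ∃ B : ℝ, ∀ (r : ℕ) (x : UnitAddCircle),
      |∑ j ∈ Finset.range r, φ (x + j • (a : UnitAddCircle)) - r * ∫ y, φ y| ≤ ε * r + B := by
  -- A closed subspace containing all characters is everything, since trigonometric polynomials are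
  -- dense.
  have htop : (⊤ : Submodule ℂ C(UnitAddCircle, ℂ)) ≤ uniformBirkhoff (a : UnitAddCircle) := by
    rw [← span_fourier_closure_eq_top]
    refine Submodule.topologicalClosure_minimal _ ?_ (isClosed_uniformBirkhoff _)
    rw [Submodule.span_le]
    rintro _ ⟨n, rfl⟩
    exact fourier_mem_uniformBirkhoff ha n
  obtain ⟨B, hB⟩ := htop (Submodule.mem_top (x := (⟨fun y => (φ y : ℂ), by fun_prop⟩ : C(UnitAddCircle, ℂ)))) ε hε
  refine ⟨B, fun r x => ?_⟩
  have h := hB r x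
  simp only [ContinuousMap.coe_mk] at h
  rw [integral_complex_ofReal] at h
  rw [← Real.norm_eq_abs, ← Complex.norm_real]
  push_cast
  exact h

/-! ### The function `|sin π x|` on the circle -/

theorem continuous_absSinPi : Continuous absSinPi :=
  Continuous.quotient_liftOn' (by fun_prop) _

theorem absSinPi_nonneg (x : UnitAddCircle) : 0 ≤ absSinPi x := by
  induction x using QuotientAddGroup.induction_on with
  | H z => exact abs_nonneg _

theorem absSinPi_pos {x : UnitAddCircle} (hx : x ≠ 0) : 0 < absSinPi x := by
  refine lt_of_le_of_ne (absSinPi_nonneg x) fun h => hx ?_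
  induction x using QuotientAddGroup.induction_on with
  | H z =>
    have h' : Real.sin (Real.pi * z) = 0 := abs_eq_zero.1 h.symm
    obtain ⟨n, hn⟩ := Real.sin_eq_zero_iff.1 h'
    refine (AddCircle.coe_eq_zero_iff 1).2 ⟨n, ?_⟩
    have := Real.pi_pos.ne'
    rw [zsmul_eq_mul, mul_one]
    apply mul_right_cancel₀ this
    linarith

/-- Jordan's inequality on the circle. -/
theorem two_mul_abs_sub_round_le (x : ℝ) : 2 * |x - round x| ≤ absSinPi (x : UnitAddCircle) := by
  have h1 : absSinPi (x : UnitAddCircle) = absSinPi ((x - round x : ℝ) : UnitAddCircle) := by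
    congr 1
    have h0 : ((round x : ℝ) : UnitAddCircle) = 0 :=
        (AddCircle.coe_eq_zero_iff 1).2 ⟨round x, by simp⟩
    rw [AddCircle.coe_sub, h0, sub_zero]
  rw [h1, absSinPi_coe]
  have h2 := abs_sub_round x
  set y := x - round x
  have hp := Real.pi_pos
  have h3 := Real.mul_abs_le_abs_sin (x := Real.pi * y) (by rw [abs_mul, abs_of_pos hp]; nlinarith)
  rw [abs_mul, abs_of_pos hp] at h3
  calc 2 * |y| = 2 / Real.pi * (Real.pi * |y|) := by field_simp
    _ ≤ _ := h3

theorem integrable_log_absSinPi :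
    Integrable (fun x : UnitAddCircle => Real.log (absSinPi x)) := by
  have hm : AEStronglyMeasurable (fun x : UnitAddCircle => Real.log (absSinPi x)) volume :=
    (Real.measurable_log.comp continuous_absSinPi.measurable).aestronglyMeasurable
  have h := UnitAddCircle.measurePreserving_mk 0
  rw [← h.integrable_comp hm]
  have h2 : IntervalIntegrable (fun x => Real.log (Real.sin (Real.pi * x))) volume 0 (0 + 1) := by
    have := (intervalIntegrable_log_sin (a := 0) (b := Real.pi)).comp_mul_left (c := Real.pi)
    simpa [Real.pi_ne_zero] using this
  rw [intervalIntegrable_iff_integrableOn_Ioc_of_le (by norm_num)] at h2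
  refine h2.congr (.of_forall fun x => ?_)
  simp [Real.log_abs]

theorem integrable_log_absSinPi_sub (ζ : UnitAddCircle) :
    Integrable (fun x : UnitAddCircle => Real.log (absSinPi (x - ζ))) :=
  integrable_log_absSinPi.comp_sub_right ζ

/-! ### Sums of logarithms over separated points -/

/-- Only indices below `K = ⌊Y⌋₊` contribute, and they sum to `log (Y ^ K / K!)`. The argument is
one term of the series of `exp Y`. -/
theorem sum_posLog_div_le {Y : ℝ} (hY : 0 ≤ Y) (N : ℕ) :
    ∑ i ∈ Finset.range N, max 0 (Real.log (Y / ((i : ℝ) + 1))) ≤ Y := by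
  rcases hY.eq_or_lt with rfl | hY
  · simp
  have hterm : ∀ i : ℕ, ⌊Y⌋₊ ≤ i → max 0 (Real.log (Y / ((i : ℝ) + 1))) = 0 := fun i hi => by
    refine max_eq_left (Real.log_nonpos (by positivity) ?_)
    rw [div_le_one (by positivity)]
    have := Nat.lt_floor_add_one Y
    have h' : (⌊Y⌋₊ : ℝ) ≤ i := by exact_mod_cast hi
    linarith
  have h1 : ∑ i ∈ Finset.range N, max 0 (Real.log (Y / ((i : ℝ) + 1))) ≤
      ∑ i ∈ Finset.range ⌊Y⌋₊, Real.log (Y / ((i : ℝ) + 1)) := by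
    calc _ ≤ ∑ i ∈ Finset.range (max N ⌊Y⌋₊), max 0 (Real.log (Y / ((i : ℝ) + 1))) :=
          Finset.sum_le_sum_of_subset_of_nonneg
            (Finset.range_subset_range.2 (le_max_left _ _)) (fun _ _ _ => le_max_left _ _)
      _ = ∑ i ∈ Finset.range ⌊Y⌋₊, max 0 (Real.log (Y / ((i : ℝ) + 1))) := by
          refine (Finset.sum_subset (Finset.range_subset_range.2 (le_max_right _ _)) ?_).symm
          intro i _ hi
          exact hterm i (by simpa using hi)
      _ = _ := by
          refine Finset.sum_congr rfl fun i hi => max_eq_right (Real.log_nonneg ?_)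
          rw [one_le_div (by positivity)]
          have h' : ((i + 1 : ℕ) : ℝ) ≤ ⌊Y⌋₊ := by exact_mod_cast Finset.mem_range.1 hi
          push_cast at h'
          exact h'.trans (Nat.floor_le hY.le)
  refine h1.trans ?_
  rw [← Real.log_prod (fun i _ => by positivity), Finset.prod_div_distrib, Finset.prod_const,
    Finset.card_range]
  have h2 : ∏ i ∈ Finset.range ⌊Y⌋₊, ((i : ℝ) + 1) = (⌊Y⌋₊).factorial := by
    rw [← Finset.prod_range_add_one_eq_factorial]; push_cast; rfl
  rw [h2, Real.log_le_iff_le_exp (by positivity)]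
  exact Real.pow_div_factorial_le_exp Y hY.le _

/-- Points in `[κ, ∞)` which fall into different cells of length `1 / s`. -/
theorem sum_posLog_le_of_injOn {ι : Type*} (S : Finset ι) (d : ι → ℝ) {s η κ : ℝ} (hs : 0 < s)
    (hη : 0 < η) (hκ : 0 < κ) (hd : ∀ i ∈ S, κ ≤ d i)
    (hinj : Set.InjOn (fun i => ⌊s * d i⌋₊) S) :
    ∑ i ∈ S, max 0 (Real.log (η / d i)) ≤ max 0 (Real.log (η / κ)) + η * s := by
  classical
  set b : ι → ℕ := fun i => ⌊s * d i⌋₊ with hb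
  -- Majorant by cell number: in cell `i ≥ 1` the point is at least `i / s`, while in cell 0 only
  -- the bound `κ` is available. Injectivity lets each cell be counted once.
  set G : ℕ → ℝ := fun i => if i = 0 then max 0 (Real.log (η / κ)) else
    max 0 (Real.log (η * s / i)) with hG
  have hG0 : ∀ i, 0 ≤ G i := fun i => by
    simp only [hG]; split_ifs <;> exact le_max_left _ _
  have h1 : ∀ i ∈ S, max 0 (Real.log (η / d i)) ≤ G (b i) := fun i hi => by
    have hdi : 0 < d i := hκ.trans_le (hd i hi)
    simp only [hG]
    split_ifs with h0
    · exact max_le_max le_rfl (Real.log_le_log (by positivity) (by gcongr; exact hd i hi))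
    · have hbi : (0 : ℝ) < b i := by exact_mod_cast Nat.pos_of_ne_zero h0
      refine max_le_max le_rfl (Real.log_le_log (by positivity) ?_)
      have h2 : (b i : ℝ) ≤ s * d i := Nat.floor_le (by positivity)
      rw [div_le_div_iff₀ hdi hbi]
      nlinarith
  calc ∑ i ∈ S, max 0 (Real.log (η / d i)) ≤ ∑ i ∈ S, G (b i) := Finset.sum_le_sum h1
    _ = ∑ k ∈ S.image b, G k := (Finset.sum_image hinj).symm
    _ ≤ ∑ k ∈ Finset.range ((S.image b).sup id + 1), G k := by
        refine Finset.sum_le_sum_of_subset_of_nonneg ?_ fun _ _ _ => hG0 _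
        intro k hk
        exact Finset.mem_range.2 (Nat.lt_succ_of_le (Finset.le_sup (f := id) hk))
    _ = ∑ k ∈ Finset.range ((S.image b).sup id), G (k + 1) + G 0 := Finset.sum_range_succ' _ _
    _ ≤ η * s + max 0 (Real.log (η / κ)) := by
        gcongr
        · have := sum_posLog_div_le (Y := η * s) (by positivity) ((S.image b).sup id)
          simpa [hG] using this
        · simp [hG]
    _ = _ := add_comm _ _

/-- Along `r ≤ q` points of an orbit which is `1 / (2q)`-separated modulo one and stays `κ`-away
from the integers, the part of `log |sin π y|` below `log η` contributes little. -/
theorem sum_log_max_sub_log_le {α y κ η : ℝ} {q r : ℕ} (hq : 0 < q) (hr : r ≤ q)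
    (hη : 0 < η) (hκ : 0 < κ)
    (hsep : ∀ k : ℤ, k ≠ 0 → |k| < q → ∀ l : ℤ, 1 / (2 * (q : ℝ)) ≤ |k * α - l|)
    (hlow : ∀ j < r, ∀ l : ℤ, κ ≤ |y + j * α - l|) :
    ∑ j ∈ Finset.range r, (Real.log (max (absSinPi ((y + j * α : ℝ) : UnitAddCircle)) η) -
        Real.log (absSinPi ((y + j * α : ℝ) : UnitAddCircle))) ≤
      2 * (max 0 (Real.log (η / κ)) + 2 * η * q) := by
  have hq' : (0 : ℝ) < q := by exact_mod_cast hq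
  set u : ℕ → ℝ := fun j => y + j * α - round (y + j * α) with hu
  have hterm : ∀ j ∈ Finset.range r,
      Real.log (max (absSinPi ((y + j * α : ℝ) : UnitAddCircle)) η) -
        Real.log (absSinPi ((y + j * α : ℝ) : UnitAddCircle)) ≤
      max 0 (Real.log (η / |u j|)) := fun j hj => by
    have hlo := hlow j (Finset.mem_range.1 hj) (round (y + j * α))
    have hupos : 0 < |u j| := hκ.trans_le hlo
    have hJ := two_mul_abs_sub_round_le (y + j * α)
    set a := absSinPi ((y + j * α : ℝ) : UnitAddCircle)
    have ha : |u j| ≤ a := by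
      have : 2 * |u j| ≤ a := hJ
      linarith
    have ha0 : 0 < a := hupos.trans_le ha
    rcases le_total η a with h | h
    · rw [max_eq_left h, sub_self]; exact le_max_left _ _
    · rw [max_eq_right h, ← Real.log_div hη.ne' ha0.ne']
      exact le_max_of_le_right (Real.log_le_log (by positivity) (by gcongr))
  -- The difference `u i - u j` is `(i - j) * α` minus an integer, to which the separation
  -- hypothesis applies.
  have hcell : ∀ i ∈ Finset.range r, ∀ j ∈ Finset.range r,
      |u i - u j| < 1 / (2 * (q : ℝ)) → i = j := fun i hi j hj h => by
    by_contra hij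
    have hi' := Finset.mem_range.1 hi
    have hj' := Finset.mem_range.1 hj
    have := hsep ((i : ℤ) - j) (by omega) (by rw [abs_lt]; omega)
      (round (y + i * α) - round (y + j * α))
    refine absurd h (not_lt.2 (this.trans_eq ?_))
    congr 1
    simp only [hu]
    push_cast
    ring
  have hfloor : ∀ a b : ℝ, 0 ≤ a → 0 ≤ b → ⌊2 * (q : ℝ) * a⌋₊ = ⌊2 * (q : ℝ) * b⌋₊ →
      |a - b| < 1 / (2 * (q : ℝ)) := fun a b ha hb h => by
    have h1 := Nat.floor_le (a := 2 * (q : ℝ) * a) (by positivity)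
    have h2 := Nat.floor_le (a := 2 * (q : ℝ) * b) (by positivity)
    have h3 := Nat.lt_floor_add_one (2 * (q : ℝ) * a)
    have h4 := Nat.lt_floor_add_one (2 * (q : ℝ) * b)
    rw [h] at h1 h3
    rw [lt_div_iff₀ (by positivity)]
    rcases abs_cases (a - b) with ⟨h5, -⟩ | ⟨h5, -⟩ <;> rw [h5] <;> nlinarith
  refine (Finset.sum_le_sum hterm).trans ?_
  -- Passing to `|u j|` preserves separation only among points on the same side of 0; treating the
  -- two sides separately accounts for the factor 2.
  rw [← Finset.sum_filter_add_sum_filter_not (Finset.range r) (fun j => 0 ≤ u j), two_mul]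
  have hbound : ∀ S ⊆ Finset.range r, (∀ i ∈ S, ∀ j ∈ S, |u i - u j| = |(|u i| - |u j|)|) →
      ∑ i ∈ S, max 0 (Real.log (η / |u i|)) ≤ max 0 (Real.log (η / κ)) + 2 * η * q := by
    intro S hS hsgn
    have := sum_posLog_le_of_injOn S (fun i => |u i|) (s := 2 * (q : ℝ)) (by positivity) hη hκ
      (fun i hi => hlow i (Finset.mem_range.1 (hS hi)) _) ?_
    · refine this.trans_eq (by ring)
    · intro i hi j hj hij
      refine hcell i (hS hi) j (hS hj) ?_
      rw [hsgn i hi j hj]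
      exact hfloor _ _ (abs_nonneg _) (abs_nonneg _) hij
  refine add_le_add (hbound _ (Finset.filter_subset _ _) ?_)
    (hbound _ (Finset.filter_subset _ _) ?_)
  · intro i hi j hj
    rw [abs_of_nonneg (Finset.mem_filter.1 hi).2, abs_of_nonneg (Finset.mem_filter.1 hj).2]
  · intro i hi j hj
    rw [abs_of_neg (not_le.1 (Finset.mem_filter.1 hi).2),
      abs_of_neg (not_le.1 (Finset.mem_filter.1 hj).2), ← abs_neg]
    congr 1; ring

/-! ### Iterates of a cocycle -/

theorem iterate_add (α : ℝ) (M : UnitAddCircle → Matrix (Fin 2) (Fin 2) ℝ) (k n : ℕ)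
    (x : UnitAddCircle) :
    iterate α M (k + n) x = iterate α M k (x + n • (α : UnitAddCircle)) * iterate α M n x := by
  induction k with
  | zero => simp [iterate]
  | succ k ih =>
    rw [Nat.succ_add, iterate, ih, iterate, mul_assoc, add_nsmul, add_assoc,
      add_comm (k • (α : UnitAddCircle))]

theorem norm_iterate_le_pow {α : ℝ} {M : UnitAddCircle → Matrix (Fin 2) (Fin 2) ℝ} {C : ℝ}
    (hM : ∀ x, ‖M x‖ ≤ C) (n : ℕ) (x : UnitAddCircle) : ‖iterate α M n x‖ ≤ C ^ n := by
  induction n with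
  | zero => simp [iterate]
  | succ n ih =>
    rw [iterate, pow_succ']
    exact (norm_mul_le _ _).trans
      (mul_le_mul (hM _) ih (norm_nonneg _) ((norm_nonneg _).trans (hM x)))

theorem norm_iterate_mul_le_prod (α : ℝ) (M : UnitAddCircle → Matrix (Fin 2) (Fin 2) ℝ) (N k : ℕ)
    (x : UnitAddCircle) :
    ‖iterate α M (k * N) x‖ ≤
      ∏ i ∈ Finset.range k, ‖iterate α M N (x + i • (N • (α : UnitAddCircle)))‖ := by
  induction k with
  | zero => simp [iterate]
  | succ k ih =>
    rw [Nat.succ_mul, add_comm, iterate_add, Finset.prod_range_succ, mul_comm (∏ i ∈ _, _), mul_smul]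
    exact (norm_mul_le _ _).trans (by gcongr)

theorem iterate_smul (α : ℝ) (h : UnitAddCircle → ℝ)
    (M : UnitAddCircle → Matrix (Fin 2) (Fin 2) ℝ) (n : ℕ) (x : UnitAddCircle) :
    iterate α (fun y => h y • M y) n x =
      (∏ j ∈ Finset.range n, h (x + j • (α : UnitAddCircle))) • iterate α M n x := by
  induction n with
  | zero => simp [iterate]
  | succ n ih =>
    rw [iterate, ih, iterate, Finset.prod_range_succ, smul_mul_smul_comm, mul_comm]

theorem iterate_congr {α : ℝ} {M M' : UnitAddCircle → Matrix (Fin 2) (Fin 2) ℝ} {n : ℕ}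
    {x : UnitAddCircle}
    (h : ∀ j < n, M (x + j • (α : UnitAddCircle)) = M' (x + j • (α : UnitAddCircle))) :
    iterate α M n x = iterate α M' n x := by
  induction n with
  | zero => rfl
  | succ n ih =>
    rw [iterate, iterate, h n n.lt_succ_self, ih fun j hj => h j (by omega)]

theorem det_iterate {α : ℝ} {M : UnitAddCircle → Matrix (Fin 2) (Fin 2) ℝ}
    (hM : ∀ x, (M x).det = 1) (n : ℕ) (x : UnitAddCircle) : (iterate α M n x).det = 1 := by
  induction n with
  | zero => simp [iterate]
  | succ n ih => rw [iterate, Matrix.det_mul, hM, ih, mul_one]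

/-- In dimension two the adjugate is the transpose conjugated by a quarter turn, so its norm is at
most `‖A‖`, and `1 = ‖A * A.adjugate‖ ≤ ‖A‖ ^ 2`. -/
theorem one_le_norm_of_det_eq_one {A : Matrix (Fin 2) (Fin 2) ℝ} (hA : A.det = 1) : 1 ≤ ‖A‖ := by
  set J : Matrix (Fin 2) (Fin 2) ℝ := !![0, 1; -1, 0] with hJ
  have hJJ : J.conjTranspose * J = 1 := by
    ext i j
    fin_cases i <;> fin_cases j <;>
      simp [hJ, Matrix.mul_apply, Fin.sum_univ_two]
  have hJn : ‖J‖ * ‖J‖ = 1 := by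
    rw [← Matrix.l2_opNorm_conjTranspose_mul_self, hJJ, norm_one]
  have hJ1 : ‖J‖ = 1 := by nlinarith [norm_nonneg J]
  have hadj : A.adjugate = J * A.conjTranspose * J.conjTranspose := by
    rw [Matrix.adjugate_fin_two]
    ext i j
    fin_cases i <;> fin_cases j <;>
      simp [hJ, Matrix.mul_apply, Fin.sum_univ_two, Matrix.vecMul, dotProduct]
  have h1 : ‖A.adjugate‖ ≤ ‖A‖ := by
    rw [hadj]
    refine (norm_mul_le _ _).trans ?_
    rw [Matrix.l2_opNorm_conjTranspose, hJ1, mul_one]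
    refine (norm_mul_le _ _).trans ?_
    rw [Matrix.l2_opNorm_conjTranspose, hJ1, one_mul]
  have h2 : A * A.adjugate = 1 := by rw [Matrix.mul_adjugate, hA, one_smul]
  have h3 : 1 ≤ ‖A‖ * ‖A.adjugate‖ := by
    rw [← norm_one (α := Matrix (Fin 2) (Fin 2) ℝ), ← h2]; exact norm_mul_le _ _
  nlinarith [norm_nonneg A]

theorem continuous_iterate {X : Type*} [TopologicalSpace X] {α : ℝ}
    {M : X → UnitAddCircle → Matrix (Fin 2) (Fin 2) ℝ}
    (hM : Continuous fun p : X × UnitAddCircle => M p.1 p.2) (n : ℕ) :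
    Continuous fun p : X × UnitAddCircle => iterate α (M p.1) n p.2 := by
  induction n with
  | zero => exact continuous_const
  | succ n ih =>
    have : Continuous fun p : X × UnitAddCircle => M p.1 (p.2 + n • (α : UnitAddCircle)) :=
      hM.comp (g := fun p : X × UnitAddCircle => M p.1 p.2)
        (f := fun p : X × UnitAddCircle => (p.1, p.2 + n • (α : UnitAddCircle))) (by fun_prop)
    exact this.mul ih

/-! ### The transfer matrix and its continuous multiple -/

/-- The continuous matrix `f · A^E`. -/
def clearedMatrix (f g : UnitAddCircle → ℝ) (E : ℝ) (x : UnitAddCircle) :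
    Matrix (Fin 2) (Fin 2) ℝ :=
  !![E * f x - g x, -f x; f x, 0]

theorem continuous_clearedMatrix {f g : UnitAddCircle → ℝ} (hf : Continuous f)
    (hg : Continuous g) :
    Continuous fun p : ℝ × UnitAddCircle => clearedMatrix f g p.1 p.2 := by
  refine continuous_matrix fun i j => ?_
  fin_cases i <;> fin_cases j <;> simp [clearedMatrix] <;> fun_prop

theorem clearedMatrix_eq_smul {f g : UnitAddCircle → ℝ} {E : ℝ} {x : UnitAddCircle}
    (h : f x ≠ 0) : clearedMatrix f g E x = f x • transferMatrix f g E x := by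
  ext i j
  fin_cases i <;> fin_cases j <;> simp [clearedMatrix, transferMatrix]
  field_simp

theorem det_transferMatrix (f g : UnitAddCircle → ℝ) (E : ℝ) (x : UnitAddCircle) :
    (transferMatrix f g E x).det = 1 := by
  simp [transferMatrix, Matrix.det_fin_two]

theorem one_le_norm_iterate_transferMatrix (α : ℝ) (f g : UnitAddCircle → ℝ) (E : ℝ) (n : ℕ)
    (x : UnitAddCircle) : 1 ≤ ‖iterate α (transferMatrix f g E) n x‖ :=
  one_le_norm_of_det_eq_one (det_iterate (det_transferMatrix f g E) n x)

theorem norm_iterate_clearedMatrix {α : ℝ} {f g : UnitAddCircle → ℝ} {E : ℝ} {n : ℕ}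
    {x : UnitAddCircle} (h : ∀ j < n, f (x + j • (α : UnitAddCircle)) ≠ 0) :
    ‖iterate α (clearedMatrix f g E) n x‖ =
      (∏ j ∈ Finset.range n, |f (x + j • (α : UnitAddCircle))|) *
        ‖iterate α (transferMatrix f g E) n x‖ := by
  rw [iterate_congr (M' := fun y => f y • transferMatrix f g E y)
    fun j hj => clearedMatrix_eq_smul (h j hj), iterate_smul, norm_smul, norm_prod]
  rfl

theorem norm_iterate_clearedMatrix_pos {α : ℝ} {f g : UnitAddCircle → ℝ} {E : ℝ} {n : ℕ}
    {x : UnitAddCircle} (h : ∀ j < n, f (x + j • (α : UnitAddCircle)) ≠ 0) :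
    0 < ‖iterate α (clearedMatrix f g E) n x‖ := by
  rw [norm_iterate_clearedMatrix h]
  exact mul_pos (Finset.prod_pos fun j hj => abs_pos.2 (h j (Finset.mem_range.1 hj)))
    (one_pos.trans_le (one_le_norm_iterate_transferMatrix α f g E n x))

/-- This identity separates the unbounded cocycle into a continuous cocycle and a scalar Birkhoff
sum. -/
theorem log_norm_iterate_transferMatrix {α : ℝ} {f g : UnitAddCircle → ℝ} {E : ℝ} {n : ℕ}
    {x : UnitAddCircle} (h : ∀ j < n, f (x + j • (α : UnitAddCircle)) ≠ 0) :
    Real.log ‖iterate α (transferMatrix f g E) n x‖ =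
      Real.log ‖iterate α (clearedMatrix f g E) n x‖ -
        ∑ j ∈ Finset.range n, Real.log |f (x + j • (α : UnitAddCircle))| := by
  have h1 : ∀ j ∈ Finset.range n, |f (x + j • (α : UnitAddCircle))| ≠ 0 := fun j hj =>
    (abs_pos.2 (h j (Finset.mem_range.1 hj))).ne'
  have h2 := one_le_norm_iterate_transferMatrix α f g E n x
  rw [norm_iterate_clearedMatrix h, Real.log_mul (Finset.prod_ne_zero_iff.2 h1) (by positivity),
    Real.log_prod h1]
  ring

/-! ### The Lyapunov exponent -/

section Lyapunov

variable {α : ℝ} {f g : UnitAddCircle → ℝ}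

theorem ae_forall_lt_orbit_ne_zero (α : ℝ) (hf0 : ∀ᵐ x : UnitAddCircle, f x ≠ 0) (n : ℕ) :
    ∀ᵐ x : UnitAddCircle, ∀ j < n, f (x + j • (α : UnitAddCircle)) ≠ 0 := by
  rw [ae_all_iff]
  intro j
  filter_upwards [(measurePreserving_add_right (volume : Measure UnitAddCircle)
    (j • (α : UnitAddCircle))).quasiMeasurePreserving.ae hf0] with x hx _ using hx

theorem integrable_sum_log_abs (α : ℝ)
    (hlog : Integrable fun x : UnitAddCircle => Real.log |f x|) (n : ℕ) :
    Integrable fun x : UnitAddCircle =>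
      ∑ j ∈ Finset.range n, Real.log |f (x + j • (α : UnitAddCircle))| :=
  integrable_finsetSum _ fun _ _ => hlog.comp_add_right _

theorem integral_sum_log_abs (α : ℝ)
    (hlog : Integrable fun x : UnitAddCircle => Real.log |f x|) (n : ℕ) :
    ∫ x : UnitAddCircle, ∑ j ∈ Finset.range n, Real.log |f (x + j • (α : UnitAddCircle))| =
      n * ∫ x : UnitAddCircle, Real.log |f x| := by
  rw [integral_finsetSum _ fun _ _ => hlog.comp_add_right _]
  have : ∀ j ∈ Finset.range n,
      ∫ x : UnitAddCircle, Real.log |f (x + j • (α : UnitAddCircle))| =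
        ∫ x : UnitAddCircle, Real.log |f x| := fun j _ =>
    integral_add_right_eq_self (fun x => Real.log |f x|) _
  rw [Finset.sum_congr rfl this]
  simp

theorem continuous_iterate_clearedMatrix (hf : Continuous f) (hg : Continuous g) (E : ℝ) (n : ℕ) :
    Continuous fun x => iterate α (clearedMatrix f g E) n x :=
  (continuous_iterate (continuous_clearedMatrix hf hg) n).comp
    (f := fun x : UnitAddCircle => (E, x)) (by fun_prop)

/-- The logarithm is nonnegative because the determinant is 1, and almost everywhere at most `log K
- ∑ log |f|`, where `K` bounds the continuous iterate. -/
theorem integrable_log_norm_iterate (hf : Continuous f) (hg : Continuous g)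
    (hf0 : ∀ᵐ x : UnitAddCircle, f x ≠ 0)
    (hlog : Integrable fun x : UnitAddCircle => Real.log |f x|) (E : ℝ) (n : ℕ) :
    Integrable fun x : UnitAddCircle => Real.log ‖iterate α (transferMatrix f g E) n x‖ := by
  have hc := continuous_iterate_clearedMatrix (α := α) hf hg E n
  obtain ⟨K, hK⟩ := (isCompact_range hc.norm).bddAbove
  have hae := ae_forall_lt_orbit_ne_zero α hf0 n
  have hsum := integrable_sum_log_abs α hlog n
  have hm : AEStronglyMeasurable
      (fun x : UnitAddCircle => Real.log ‖iterate α (transferMatrix f g E) n x‖) volume := by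
    refine (((Real.measurable_log.comp hc.norm.measurable).aestronglyMeasurable).sub
      hsum.aestronglyMeasurable).congr ?_
    filter_upwards [hae] with x hx
    exact (log_norm_iterate_transferMatrix hx).symm
  refine ((integrable_const (Real.log K)).sub hsum).mono' hm ?_
  filter_upwards [hae] with x hx
  rw [Real.norm_of_nonneg (Real.log_nonneg (one_le_norm_iterate_transferMatrix α f g E n x)),
    log_norm_iterate_transferMatrix hx]
  exact sub_le_sub_right
    (Real.log_le_log (norm_iterate_clearedMatrix_pos hx) (hK ⟨x, rfl⟩)) _

theorem integrable_log_norm_iterate_clearedMatrix (hf : Continuous f) (hg : Continuous g)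
    (hf0 : ∀ᵐ x : UnitAddCircle, f x ≠ 0)
    (hlog : Integrable fun x : UnitAddCircle => Real.log |f x|) (E : ℝ) (n : ℕ) :
    Integrable fun x : UnitAddCircle => Real.log ‖iterate α (clearedMatrix f g E) n x‖ := by
  refine ((integrable_log_norm_iterate (α := α) hf hg hf0 hlog E n).add
    (integrable_sum_log_abs α hlog n)).congr ?_
  filter_upwards [ae_forall_lt_orbit_ne_zero α hf0 n] with x hx
  simp only [Pi.add_apply]
  rw [log_norm_iterate_transferMatrix hx]
  ring

theorem integral_log_norm_iterate_clearedMatrix (hf : Continuous f) (hg : Continuous g)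
    (hf0 : ∀ᵐ x : UnitAddCircle, f x ≠ 0)
    (hlog : Integrable fun x : UnitAddCircle => Real.log |f x|) (E : ℝ) (n : ℕ) :
    ∫ x : UnitAddCircle, Real.log ‖iterate α (clearedMatrix f g E) n x‖ =
      (∫ x : UnitAddCircle, Real.log ‖iterate α (transferMatrix f g E) n x‖) +
        n * ∫ x : UnitAddCircle, Real.log |f x| := by
  rw [← integral_sum_log_abs α hlog n, ← integral_add
    (integrable_log_norm_iterate hf hg hf0 hlog E n) (integrable_sum_log_abs α hlog n)]
  refine integral_congr_ae ?_
  filter_upwards [ae_forall_lt_orbit_ne_zero α hf0 n] with x hx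
  rw [log_norm_iterate_transferMatrix hx]
  ring

/-- Through Fekete's lemma this gives both the existence of the limit and its domination by each
average. -/
theorem subadditive_integral_log_norm_iterate (hf : Continuous f) (hg : Continuous g)
    (hf0 : ∀ᵐ x : UnitAddCircle, f x ≠ 0)
    (hlog : Integrable fun x : UnitAddCircle => Real.log |f x|) (E : ℝ) :
    Subadditive fun n => ∫ x : UnitAddCircle, Real.log ‖iterate α (transferMatrix f g E) n x‖ := by
  intro k n
  have hk := integrable_log_norm_iterate (α := α) hf hg hf0 hlog E k
  have hn := integrable_log_norm_iterate (α := α) hf hg hf0 hlog E n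
  beta_reduce
  rw [← integral_add_right_eq_self
    (fun x => Real.log ‖iterate α (transferMatrix f g E) k x‖) (n • (α : UnitAddCircle)),
    ← integral_add (hk.comp_add_right _) hn]
  refine integral_mono (integrable_log_norm_iterate hf hg hf0 hlog E (k + n))
    ((hk.comp_add_right _).add hn) fun x => ?_
  have h1 := one_le_norm_iterate_transferMatrix α f g E
  have hp : ∀ n x, 0 < ‖iterate α (transferMatrix f g E) n x‖ := fun n x =>
    one_pos.trans_le (h1 n x)
  beta_reduce
  rw [← Real.log_mul (hp _ _).ne' (hp _ _).ne', iterate_add]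
  refine Real.log_le_log ?_ (norm_mul_le _ _)
  rw [← iterate_add]
  exact hp _ _

theorem integral_log_norm_iterate_nonneg (α : ℝ) (f g : UnitAddCircle → ℝ) (E : ℝ) (n : ℕ) :
    0 ≤ ∫ x : UnitAddCircle, Real.log ‖iterate α (transferMatrix f g E) n x‖ :=
  integral_nonneg fun x => Real.log_nonneg (one_le_norm_iterate_transferMatrix α f g E n x)

theorem bddBelow_integral_log_norm_iterate_div (α : ℝ) (f g : UnitAddCircle → ℝ) (E : ℝ) :
    BddBelow (Set.range fun n : ℕ =>
      (∫ x : UnitAddCircle, Real.log ‖iterate α (transferMatrix f g E) n x‖) / n) := by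
  refine ⟨0, ?_⟩
  rintro _ ⟨n, rfl⟩
  exact div_nonneg (integral_log_norm_iterate_nonneg α f g E n) n.cast_nonneg

theorem lyapunovAverage_eq_div (α : ℝ) (M : UnitAddCircle → Matrix (Fin 2) (Fin 2) ℝ) (n : ℕ) :
    lyapunovAverage α M n = (∫ x : UnitAddCircle, Real.log ‖iterate α M n x‖) / n := by
  rw [lyapunovAverage, one_div, inv_mul_eq_div]

theorem lyapunov_eq_lim (hf : Continuous f) (hg : Continuous g)
    (hf0 : ∀ᵐ x : UnitAddCircle, f x ≠ 0)
    (hlog : Integrable fun x : UnitAddCircle => Real.log |f x|) (E : ℝ) :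
    lyapunov α (transferMatrix f g E) =
      (subadditive_integral_log_norm_iterate (α := α) hf hg hf0 hlog E).lim := by
  refine Tendsto.limUnder_eq ?_
  simpa only [← lyapunovAverage_eq_div] using
    (subadditive_integral_log_norm_iterate (α := α) hf hg hf0 hlog E).tendsto_lim
      (bddBelow_integral_log_norm_iterate_div α f g E)

theorem tendsto_lyapunovAverage (hf : Continuous f) (hg : Continuous g)
    (hf0 : ∀ᵐ x : UnitAddCircle, f x ≠ 0)
    (hlog : Integrable fun x : UnitAddCircle => Real.log |f x|) (E : ℝ) :
    Tendsto (lyapunovAverage α (transferMatrix f g E)) atTop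
      (𝓝 (lyapunov α (transferMatrix f g E))) := by
  rw [lyapunov_eq_lim hf hg hf0 hlog]
  simpa only [← lyapunovAverage_eq_div] using
    (subadditive_integral_log_norm_iterate (α := α) hf hg hf0 hlog E).tendsto_lim
      (bddBelow_integral_log_norm_iterate_div α f g E)

theorem lyapunov_le_average (hf : Continuous f) (hg : Continuous g)
    (hf0 : ∀ᵐ x : UnitAddCircle, f x ≠ 0)
    (hlog : Integrable fun x : UnitAddCircle => Real.log |f x|) (E : ℝ) {n : ℕ} (hn : n ≠ 0) :
    lyapunov α (transferMatrix f g E) ≤ lyapunovAverage α (transferMatrix f g E) n := by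
  rw [lyapunov_eq_lim hf hg hf0 hlog, lyapunovAverage_eq_div]
  exact Subadditive.lim_le_div _ (bddBelow_integral_log_norm_iterate_div α f g E) hn

theorem lyapunov_nonneg (hf : Continuous f) (hg : Continuous g)
    (hf0 : ∀ᵐ x : UnitAddCircle, f x ≠ 0)
    (hlog : Integrable fun x : UnitAddCircle => Real.log |f x|) (E : ℝ) :
    0 ≤ lyapunov α (transferMatrix f g E) := by
  refine ge_of_tendsto' (tendsto_lyapunovAverage hf hg hf0 hlog E) fun n => ?_
  rw [lyapunovAverage_eq_div]
  exact div_nonneg (integral_log_norm_iterate_nonneg α f g E n) n.cast_nonneg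

/-- The exponent is at most the average with `n = 1`, which is bounded through the cleared matrix on
`I` times the circle. -/
theorem bddAbove_lyapunov_image (hf : Continuous f) (hg : Continuous g)
    (hf0 : ∀ᵐ x : UnitAddCircle, f x ≠ 0)
    (hlog : Integrable fun x : UnitAddCircle => Real.log |f x|) {I : Set ℝ} (hI : IsCompact I) :
    BddAbove ((fun E => lyapunov α (transferMatrix f g E)) '' I) := by
  have hc : Continuous fun p : ℝ × UnitAddCircle => ‖iterate α (clearedMatrix f g p.1) 1 p.2‖ :=
    (continuous_iterate (continuous_clearedMatrix hf hg) 1).norm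
  obtain ⟨K, hK⟩ := (hI.prod isCompact_univ).bddAbove_image hc.continuousOn
  refine ⟨Real.log K - ∫ x : UnitAddCircle, Real.log |f x|, ?_⟩
  rintro _ ⟨E, hE, rfl⟩
  refine (lyapunov_le_average hf hg hf0 hlog E one_ne_zero).trans ?_
  have h := integral_log_norm_iterate_clearedMatrix (α := α) hf hg hf0 hlog E 1
  rw [lyapunovAverage_eq_div, Nat.cast_one, div_one]
  have h2 : ∫ x : UnitAddCircle, Real.log ‖iterate α (clearedMatrix f g E) 1 x‖ ≤ Real.log K := by
    calc _ ≤ ∫ _ : UnitAddCircle, Real.log K := by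
          refine integral_mono_ae
            (integrable_log_norm_iterate_clearedMatrix hf hg hf0 hlog E 1) (integrable_const _) ?_
          filter_upwards [ae_forall_lt_orbit_ne_zero α hf0 1] with x hx
          exact Real.log_le_log (norm_iterate_clearedMatrix_pos hx) (hK ⟨(E, x), ⟨hE, trivial⟩, rfl⟩)
      _ = Real.log K := by simp
  rw [Nat.cast_one, one_mul] at h
  linarith

/-- Lower truncations of `log ‖Mₙ‖` have integrals converging to that of `log ‖Mₙ‖`. -/
theorem exists_integral_log_max_lt {h : UnitAddCircle → ℝ} (hh : Continuous h)
    (hpos : ∀ᵐ x : UnitAddCircle, 0 < h x)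
    (hint : Integrable fun x : UnitAddCircle => Real.log (h x)) {c : ℝ}
    (hc : ∫ x : UnitAddCircle, Real.log (h x) < c) :
    ∃ η : ℝ, 0 < η ∧ ∫ x : UnitAddCircle, Real.log (max (h x) η) < c := by
  have hu : Tendsto (fun n : ℕ => 1 / ((n : ℝ) + 1)) atTop (𝓝 0) :=
    tendsto_one_div_add_atTop_nhds_zero_nat
  have hlim : Tendsto (fun n : ℕ => ∫ x : UnitAddCircle, Real.log (max (h x) (1 / ((n : ℝ) + 1))))
      atTop (𝓝 (∫ x : UnitAddCircle, Real.log (h x))) := by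
    -- The truncation levels are at most 1, so truncation only moves negative values of `log (h x)`
    -- towards 0 and `|log (h x)|` dominates.
    refine tendsto_integral_of_dominated_convergence (fun x => |Real.log (h x)|) (fun n => ?_)
      hint.abs (fun n => ?_) ?_
    · exact (Real.measurable_log.comp
        (hh.max continuous_const).measurable).aestronglyMeasurable
    · filter_upwards [hpos] with x hx
      have hn : (0 : ℝ) < 1 / ((n : ℝ) + 1) := by positivity
      have hn1 : 1 / ((n : ℝ) + 1) ≤ 1 := by
        rw [div_le_one (by positivity)]; linarith [n.cast_nonneg (α := ℝ)]
      rw [Real.norm_eq_abs]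
      rcases le_total (1 / ((n : ℝ) + 1)) (h x) with h1 | h1
      · rw [max_eq_left h1]
      · rw [max_eq_right h1, abs_of_nonpos (Real.log_nonpos hn.le hn1),
          abs_of_nonpos (Real.log_nonpos hx.le (h1.trans hn1))]
        exact neg_le_neg (Real.log_le_log hx h1)
    · filter_upwards [hpos] with x hx
      have h2 : Tendsto (fun n : ℕ => max (h x) (1 / ((n : ℝ) + 1))) atTop (𝓝 (max (h x) 0)) :=
        tendsto_const_nhds.max hu
      rw [max_eq_left hx.le] at h2
      exact h2.log hx.ne'
  obtain ⟨n, hn⟩ := (hlim.eventually_lt_const hc).exists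
  exact ⟨_, by positivity, hn⟩

/-- Upper semicontinuity of the Lyapunov exponent, with a uniform bound on all iterates. -/
theorem exists_norm_iterate_clearedMatrix_le (hα : Irrational α) (hf : Continuous f)
    (hg : Continuous g) (hf0 : ∀ᵐ x : UnitAddCircle, f x ≠ 0)
    (hlog : Integrable fun x : UnitAddCircle => Real.log |f x|) (E₀ : ℝ) {ε : ℝ} (hε : 0 < ε) :
    ∃ B : ℝ, ∀ᶠ E in 𝓝 E₀, ∀ (r : ℕ) (x : UnitAddCircle),
      ‖iterate α (clearedMatrix f g E) r x‖ ≤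
        Real.exp (r * (lyapunov α (transferMatrix f g E₀) +
          (∫ y : UnitAddCircle, Real.log |f y|) + ε) + B) := by
  set L := lyapunov α (transferMatrix f g E₀)
  set c := ∫ y : UnitAddCircle, Real.log |f y|
  obtain ⟨N, hN, hN0⟩ := (((tendsto_lyapunovAverage (α := α) hf hg hf0 hlog E₀).eventually_lt_const
    (show L < L + ε / 4 by linarith)).and (eventually_ge_atTop 1)).exists
  have hNpos : (0 : ℝ) < N := by exact_mod_cast hN0
  have hcN := continuous_iterate_clearedMatrix (α := α) hf hg E₀ N
  have hint : ∫ x : UnitAddCircle, Real.log ‖iterate α (clearedMatrix f g E₀) N x‖ <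
      N * (L + c + ε / 4) := by
    rw [integral_log_norm_iterate_clearedMatrix hf hg hf0 hlog]
    rw [lyapunovAverage_eq_div, div_lt_iff₀ hNpos] at hN
    change _ + N * c < _
    linarith
  have hpos : ∀ᵐ x : UnitAddCircle, 0 < ‖iterate α (clearedMatrix f g E₀) N x‖ := by
    filter_upwards [ae_forall_lt_orbit_ne_zero α hf0 N] with x hx
    exact norm_iterate_clearedMatrix_pos hx
  obtain ⟨η, hη, hηint⟩ := exists_integral_log_max_lt hcN.norm hpos
    (integrable_log_norm_iterate_clearedMatrix hf hg hf0 hlog E₀ N) hint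
  set ρ : UnitAddCircle → ℝ := fun x => max ‖iterate α (clearedMatrix f g E₀) N x‖ η with hρ
  have hρpos : ∀ x, 0 < ρ x := fun x => hη.trans_le (le_max_right _ _)
  have hρc : Continuous ρ := hcN.norm.max continuous_const
  have hψ : Continuous fun x => Real.log (ρ x) := hρc.log fun x => (hρpos x).ne'
  -- Blocks of length `N` follow the rotation by `N * α`, which is again irrational.
  obtain ⟨B, hB⟩ := exists_birkhoff_bound (hα.natCast_mul (m := N) (by omega)) hψ
    (show 0 < N * (ε / 4) by positivity)
  -- Truncation makes `ρ` positive, so the inequality is strict at `E₀` even where the iterate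
  -- vanishes, and compactness of the circle carries it to nearby energies.
  have hnear : ∀ᶠ E in 𝓝 E₀, ∀ x ∈ (Set.univ : Set UnitAddCircle),
      ‖iterate α (clearedMatrix f g E) N x‖ < Real.exp (N * (ε / 4)) * ρ x := by
    refine isCompact_univ.eventually_forall_of_forall_eventually fun x _ => ?_
    have h1 : Continuous fun p : ℝ × UnitAddCircle => ‖iterate α (clearedMatrix f g p.1) N p.2‖ :=
      (continuous_iterate (continuous_clearedMatrix hf hg) N).norm
    have h2 : Continuous fun p : ℝ × UnitAddCircle => Real.exp (N * (ε / 4)) * ρ p.2 :=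
      continuous_const.mul (hρc.comp continuous_snd)
    refine (isOpen_lt h1 h2).mem_nhds ?_
    calc ‖iterate α (clearedMatrix f g E₀) N x‖ ≤ 1 * ρ x := by
          rw [one_mul]; exact le_max_left _ _
      _ < Real.exp (N * (ε / 4)) * ρ x :=
          mul_lt_mul_of_pos_right (Real.one_lt_exp_iff.2 (by positivity)) (hρpos x)
  obtain ⟨K, hK⟩ := ((isCompact_closedBall E₀ 1).prod isCompact_univ).bddAbove_image
    (continuous_clearedMatrix hf hg).norm.continuousOn
  -- Each quarter of `ε` pays for one loss: the truncated integral over a block, the change of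
  -- energy, and the Birkhoff error.
  set V := L + c + 3 * ε / 4 with hV
  -- With `r = t + k * N` and `t < N`, the term `N * |V|` absorbs the missing `t * V`, whose sign is
  -- unknown, and the last term bounds the `t` leftover factors.
  refine ⟨N * |V| + B + N * Real.log (max K 1), ?_⟩
  filter_upwards [hnear, Metric.closedBall_mem_nhds E₀ one_pos] with E hE hEb r x
  have hstep : ∀ y, ‖clearedMatrix f g E y‖ ≤ max K 1 := fun y =>
    (hK ⟨(E, y), ⟨hEb, trivial⟩, rfl⟩).trans (le_max_left _ _)
  have hr : r = r % N + (r / N) * N := by rw [mul_comm]; exact (Nat.mod_add_div r N).symm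
  set k := r / N
  set t := r % N
  have htN : t < N := Nat.mod_lt _ hN0
  have hblock : ‖iterate α (clearedMatrix f g E) (k * N) x‖ ≤ Real.exp (k * N * V + B) := by
    refine (norm_iterate_mul_le_prod α _ N k x).trans ?_
    calc ∏ i ∈ Finset.range k, ‖iterate α (clearedMatrix f g E) N (x + i • (N • (α : UnitAddCircle)))‖
        ≤ ∏ i ∈ Finset.range k,
          Real.exp (N * (ε / 4) + Real.log (ρ (x + i • (N • (α : UnitAddCircle))))) := by
          refine Finset.prod_le_prod (fun _ _ => norm_nonneg _) fun i _ => ?_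
          rw [Real.exp_add, Real.exp_log (hρpos _)]
          exact (hE _ trivial).le
      _ = Real.exp (k * (N * (ε / 4)) +
          ∑ i ∈ Finset.range k, Real.log (ρ (x + i • (N • (α : UnitAddCircle))))) := by
          rw [← Real.exp_sum, Finset.sum_add_distrib]; simp
      _ ≤ _ := by
          refine Real.exp_le_exp.2 ?_
          have h1 := (abs_le.1 (hB k x)).2
          have h2 : ((N * α : ℝ) : UnitAddCircle) = N • (α : UnitAddCircle) := by
            rw [← nsmul_eq_mul, AddCircle.coe_nsmul]
          rw [h2] at h1
          have h3 : (k : ℝ) * ∫ y, Real.log (ρ y) ≤ k * (N * (L + c + ε / 4)) :=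
            mul_le_mul_of_nonneg_left hηint.le k.cast_nonneg
          rw [hV]
          linarith
  have hrest : ‖iterate α (clearedMatrix f g E) t (x + (k * N) • (α : UnitAddCircle))‖ ≤
      Real.exp (N * Real.log (max K 1)) := by
    have h0 : 0 < max K 1 := by positivity
    refine (norm_iterate_le_pow hstep _ _).trans ?_
    rw [mul_comm, ← Real.rpow_def_of_pos h0, Real.rpow_natCast]
    exact pow_le_pow_right₀ (le_max_right _ _) htN.le
  rw [hr, iterate_add]
  refine (norm_mul_le _ _).trans ((mul_le_mul hrest hblock (norm_nonneg _)
    (Real.exp_nonneg _)).trans ?_)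
  rw [← Real.exp_add, Real.exp_le_exp]
  push_cast
  have ht1 : (t : ℝ) ≤ N := by exact_mod_cast htN.le
  have ht0 : (0 : ℝ) ≤ t := t.cast_nonneg
  have h4 : -(t * V) ≤ N * |V| := by
    calc -(t * V) ≤ |t * V| := neg_le_abs _
      _ = t * |V| := by rw [abs_mul, abs_of_nonneg ht0]
      _ ≤ N * |V| := by gcongr
  have h5 : ((t : ℝ) + k * N) * V ≤ (t + k * N) * (L + c + ε) := by
    refine mul_le_mul_of_nonneg_left ?_ (by positivity)
    rw [hV]; linarith
  linarith

end Lyapunov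

/-! ### Typical phases -/

/-- The phases whose orbit avoids all `ζ_ℓ` and whose differences with `ζ_ℓ` are not too well
approximable by rationals. -/
def typicalPhases {m : ℕ} (α : ℝ) (ζ : Fin m → UnitAddCircle) : Set UnitAddCircle :=
  {θ | ∀ ℓ, (∀ k : ℤ, θ + k • (α : UnitAddCircle) ≠ ζ ℓ) ∧
    ∀ᶠ q : ℕ in atTop, 1 / (q : ℝ) ^ 2 ≤ ‖q • (θ - ζ ℓ)‖}

theorem ae_ne (a : UnitAddCircle) : ∀ᵐ x : UnitAddCircle, x ≠ a := by
  rw [ae_iff]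
  refine measure_mono_null (t := Metric.closedBall a 0) (fun x hx => ?_) ?_
  · simpa using hx
  · rw [AddCircle.volume_closedBall]; simp

/-- The map `θ ↦ q • (θ - ζ)` preserves Lebesgue measure, so the set is no larger than a ball of
radius `δ`. -/
theorem volume_norm_nsmul_sub_lt_le (ζ : UnitAddCircle) {q : ℕ} (hq : q ≠ 0) (δ : ℝ) :
    volume {θ : UnitAddCircle | ‖q • (θ - ζ)‖ < δ} ≤ ENNReal.ofReal (2 * δ) := by
  have h1 : MeasurePreserving (fun y : UnitAddCircle => (q : ℤ) • y) volume volume :=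
    Measure.measurePreserving_zsmul volume (by exact_mod_cast hq)
  have h2 := h1.comp (measurePreserving_sub_right (volume : Measure UnitAddCircle) ζ)
  calc volume {θ : UnitAddCircle | ‖q • (θ - ζ)‖ < δ}
      ≤ volume (((fun y : UnitAddCircle => (q : ℤ) • y) ∘ fun x => x - ζ) ⁻¹'
          Metric.closedBall 0 δ) := by
        refine measure_mono fun θ hθ => ?_
        have h3 : ‖q • (θ - ζ)‖ < δ := hθ
        simpa using h3.le
    _ = volume (Metric.closedBall (0 : UnitAddCircle) δ) :=
        h2.measure_preimage measurableSet_closedBall.nullMeasurableSet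
    _ ≤ ENNReal.ofReal (2 * δ) := by
        rw [AddCircle.volume_closedBall]
        exact ENNReal.ofReal_le_ofReal (min_le_right _ _)

/-- Hitting `ζ ℓ` excludes countably many phases; the Diophantine condition is Borel–Cantelli with
the summable bounds `2 / q ^ 2`. -/
theorem ae_mem_typicalPhases {m : ℕ} (α : ℝ) (ζ : Fin m → UnitAddCircle) :
    ∀ᵐ θ : UnitAddCircle, θ ∈ typicalPhases α ζ := by
  refine ae_all_iff.2 fun ℓ => ?_
  have h1 : ∀ᵐ θ : UnitAddCircle, ∀ k : ℤ, θ + k • (α : UnitAddCircle) ≠ ζ ℓ := by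
    refine ae_all_iff.2 fun k => ?_
    filter_upwards [ae_ne (ζ ℓ - k • (α : UnitAddCircle))] with θ hθ h
    exact hθ (eq_sub_of_add_eq h)
  have h2 : ∀ᵐ θ : UnitAddCircle, ∀ᶠ q : ℕ in atTop,
      θ ∉ {θ : UnitAddCircle | ‖q • (θ - ζ ℓ)‖ < 1 / (q : ℝ) ^ 2} := by
    refine ae_eventually_notMem (ne_top_of_le_ne_top (b := ∑' q : ℕ, ENNReal.ofReal
      (2 * (1 / (q : ℝ) ^ 2))) ?_ (ENNReal.tsum_le_tsum fun q => ?_))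
    · exact ((Real.summable_one_div_nat_pow.2 one_lt_two).mul_left 2).tsum_ofReal_ne_top
    -- At `q = 0` the radius `1 / 0` is 0 by convention and the set is empty.
    · rcases eq_or_ne q 0 with rfl | hq
      · simp
      · exact volume_norm_nsmul_sub_lt_le _ hq _
  filter_upwards [h1, h2] with θ hθ1 hθ2
  exact ⟨hθ1, hθ2.mono fun q hq => not_lt.1 hq⟩

/-! ### Functions with a factorization -/

section Factorization

variable {m : ℕ} {ζ : Fin m → UnitAddCircle} {σ : Fin m → ℝ≥0} {f F : UnitAddCircle → ℝ} {c : ℝ}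

theorem log_abs_eq_of_factorization (hc : 0 < c) (hF : ∀ x, c ≤ |F x|)
    (hf : ∀ x, f x = F x * ∏ ℓ : Fin m, absSinPi (x - ζ ℓ) ^ (σ ℓ : ℝ)) {x : UnitAddCircle}
    (hx : ∀ ℓ, x ≠ ζ ℓ) :
    f x ≠ 0 ∧
      Real.log |f x| = Real.log |F x| + ∑ ℓ, (σ ℓ : ℝ) * Real.log (absSinPi (x - ζ ℓ)) := by
  have hpos : ∀ ℓ, 0 < absSinPi (x - ζ ℓ) := fun ℓ => absSinPi_pos (sub_ne_zero.2 (hx ℓ))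
  have hp : 0 < ∏ ℓ : Fin m, absSinPi (x - ζ ℓ) ^ (σ ℓ : ℝ) :=
    Finset.prod_pos fun ℓ _ => Real.rpow_pos_of_pos (hpos ℓ) _
  have hF0 : 0 < |F x| := hc.trans_le (hF x)
  refine ⟨by rw [hf]; exact mul_ne_zero (abs_pos.1 hF0) hp.ne', ?_⟩
  rw [hf, abs_mul, abs_of_pos hp, Real.log_mul hF0.ne' hp.ne',
    Real.log_prod fun ℓ _ => (Real.rpow_pos_of_pos (hpos ℓ) _).ne']
  congr 1
  exact Finset.sum_congr rfl fun ℓ _ => Real.log_rpow (hpos ℓ) _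

theorem HasZeroFactorization.ae_ne_zero (h : HasZeroFactorization ζ σ f) :
    ∀ᵐ x : UnitAddCircle, f x ≠ 0 := by
  obtain ⟨F, -, ⟨c, hc, hF⟩, hf⟩ := h
  filter_upwards [ae_all_iff.2 fun ℓ => ae_ne (ζ ℓ)] with x hx
  exact (log_abs_eq_of_factorization hc hF hf hx).1

theorem HasZeroFactorization.integrable_log_abs (h : HasZeroFactorization ζ σ f) :
    Integrable fun x : UnitAddCircle => Real.log |f x| := by
  obtain ⟨F, hFc, ⟨c, hc, hF⟩, hf⟩ := h
  have h1 : Continuous fun x => Real.log |F x| :=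
    hFc.abs.log fun x => (hc.trans_le (hF x)).ne'
  have h2 : Integrable fun x : UnitAddCircle =>
      Real.log |F x| + ∑ ℓ, (σ ℓ : ℝ) * Real.log (absSinPi (x - ζ ℓ)) :=
    (h1.integrable_of_hasCompactSupport (.of_compactSpace _)).add
      (integrable_finsetSum _ fun ℓ _ => (integrable_log_absSinPi_sub (ζ ℓ)).const_mul _)
  refine h2.congr ?_
  filter_upwards [ae_all_iff.2 fun ℓ => ae_ne (ζ ℓ)] with x hx
  exact (log_abs_eq_of_factorization hc hF hf hx).2.symm

/-- Birkhoff sums of `log |f|` of length `r ≤ q` along orbits that stay `κ`-away from the zeros of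
`f` are not much smaller than expected. -/
theorem HasZeroFactorization.exists_sum_log_abs_ge {α : ℝ} (hα : Irrational α)
    (h : HasZeroFactorization ζ σ f) (hσ : ∀ ℓ, σ ℓ ≤ 1) {ε : ℝ} (hε : 0 < ε) :
    ∃ B : ℝ, ∀ (q r : ℕ) (κ : ℝ) (x : UnitAddCircle), 0 < q → r ≤ q → 0 < κ →
      (∀ k : ℤ, k ≠ 0 → |k| < q → ∀ l : ℤ, 1 / (2 * (q : ℝ)) ≤ |k * α - l|) →
      (∀ ℓ, ∃ y : ℝ, (y : UnitAddCircle) = x - ζ ℓ ∧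
        ∀ j < r, ∀ l : ℤ, κ ≤ |y + j * α - l|) →
      (r * ∫ y : UnitAddCircle, Real.log |f y|) - ε * q - B -
          m * (2 * max 0 (Real.log (1 / κ))) ≤
        ∑ j ∈ Finset.range r, Real.log |f (x + j • (α : UnitAddCircle))| := by
  have hint := h.integrable_log_abs
  obtain ⟨F, hFc, ⟨c, hc, hF⟩, hf⟩ := h
  -- Chosen so that the `m` singularities together cost at most `ε / 2` per unit of `q`; `η ≤ 1`
  -- gives `log (η / κ) ≤ log (1 / κ)`.
  set η : ℝ := min 1 (ε / (8 * (m + 1))) with hη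
  have hη0 : 0 < η := by positivity
  have hη1 : η ≤ 1 := min_le_left _ _
  have hηm : m * (4 * η) ≤ ε / 2 := by
    have h1 : η ≤ ε / (8 * (m + 1)) := min_le_right _ _
    rw [le_div_iff₀ (by positivity)] at h1
    nlinarith
  set ψ : UnitAddCircle → ℝ := fun x =>
    Real.log |F x| + ∑ ℓ, (σ ℓ : ℝ) * Real.log (max (absSinPi (x - ζ ℓ)) η) with hψ
  have hψc : Continuous ψ := by
    refine (hFc.abs.log fun x => (hc.trans_le (hF x)).ne').add
      (continuous_finsetSum _ fun ℓ _ => continuous_const.mul ?_)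
    exact ((continuous_absSinPi.comp (continuous_id.sub continuous_const)).max
      continuous_const).log fun x => (hη0.trans_le (le_max_right _ _)).ne'
  -- Truncation from below raises the integral, which is the favourable direction for a lower bound.
  have hψint : ∫ y : UnitAddCircle, Real.log |f y| ≤ ∫ y, ψ y := by
    refine integral_mono_ae hint (hψc.integrable_of_hasCompactSupport (.of_compactSpace _)) ?_
    filter_upwards [ae_all_iff.2 fun ℓ => ae_ne (ζ ℓ)] with x hx
    rw [(log_abs_eq_of_factorization hc hF hf hx).2]
    refine add_le_add_right (Finset.sum_le_sum fun ℓ _ => ?_) _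
    exact mul_le_mul_of_nonneg_left
      (Real.log_le_log (absSinPi_pos (sub_ne_zero.2 (hx ℓ))) (le_max_left _ _)) (σ ℓ).coe_nonneg
  obtain ⟨B, hB⟩ := exists_birkhoff_bound hα hψc (show 0 < ε / 2 by positivity)
  refine ⟨B, fun q r κ x hq hr hκ hsep hlow => ?_⟩
  choose y hy hlow using hlow
  have hpt : ∀ ℓ (j : ℕ), x + j • (α : UnitAddCircle) - ζ ℓ =
      ((y ℓ + j * α : ℝ) : UnitAddCircle) := fun ℓ j => by
    rw [AddCircle.coe_add, hy, ← nsmul_eq_mul, AddCircle.coe_nsmul]; abel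
  have hne : ∀ j < r, ∀ ℓ, x + j • (α : UnitAddCircle) ≠ ζ ℓ := fun j hj ℓ h0 => by
    have h1 := hpt ℓ j
    rw [h0, sub_self] at h1
    obtain ⟨l, hl⟩ := (AddCircle.coe_eq_zero_iff 1).1 h1.symm
    have h2 := hlow ℓ j hj l
    rw [← hl] at h2
    simp at h2
    linarith
  have hdiff : ∑ j ∈ Finset.range r, (ψ (x + j • (α : UnitAddCircle)) -
      Real.log |f (x + j • (α : UnitAddCircle))|) ≤
      m * (2 * (max 0 (Real.log (1 / κ)) + 2 * η * q)) := by
    calc _ = ∑ j ∈ Finset.range r, ∑ ℓ, (σ ℓ : ℝ) *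
          (Real.log (max (absSinPi ((y ℓ + j * α : ℝ) : UnitAddCircle)) η) -
            Real.log (absSinPi ((y ℓ + j * α : ℝ) : UnitAddCircle))) := by
          refine Finset.sum_congr rfl fun j hj => ?_
          rw [(log_abs_eq_of_factorization hc hF hf (hne j (Finset.mem_range.1 hj))).2]
          simp only [hψ, hpt, mul_sub, Finset.sum_sub_distrib]
          ring
      _ = ∑ ℓ, (σ ℓ : ℝ) * ∑ j ∈ Finset.range r,
          (Real.log (max (absSinPi ((y ℓ + j * α : ℝ) : UnitAddCircle)) η) -
            Real.log (absSinPi ((y ℓ + j * α : ℝ) : UnitAddCircle))) := by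
          rw [Finset.sum_comm]; simp only [Finset.mul_sum]
      _ ≤ ∑ _ℓ : Fin m, 2 * (max 0 (Real.log (1 / κ)) + 2 * η * q) := by
          refine Finset.sum_le_sum fun ℓ _ => ?_
          have h1 : 0 ≤ 2 * (max 0 (Real.log (1 / κ)) + 2 * η * q) := by positivity
          have h2 := sum_log_max_sub_log_le (y := y ℓ) hq hr hη0 hκ hsep (hlow ℓ)
          have h3 : 2 * (max 0 (Real.log (η / κ)) + 2 * η * q) ≤
              2 * (max 0 (Real.log (1 / κ)) + 2 * η * q) := by gcongr
          calc _ ≤ (σ ℓ : ℝ) * (2 * (max 0 (Real.log (1 / κ)) + 2 * η * q)) :=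
                mul_le_mul_of_nonneg_left (h2.trans h3) (σ ℓ).coe_nonneg
            _ ≤ 1 * (2 * (max 0 (Real.log (1 / κ)) + 2 * η * q)) :=
                mul_le_mul_of_nonneg_right (by exact_mod_cast hσ ℓ) h1
            _ = _ := one_mul _
      _ = _ := by simp
  rw [Finset.sum_sub_distrib] at hdiff
  have h1 := (abs_le.1 (hB r x)).1
  have h2 : (r : ℝ) * ∫ y : UnitAddCircle, Real.log |f y| ≤ r * ∫ y, ψ y :=
    mul_le_mul_of_nonneg_left hψint r.cast_nonneg
  have h3 : ε / 2 * (r : ℝ) ≤ ε / 2 * q := by gcongr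
  have h4 : m * (4 * η) * (q : ℝ) ≤ ε / 2 * q := by gcongr
  linarith

end Factorization

/-- Along resonant denominators, long orbit segments of a typical phase stay away from `ζ_ℓ`. -/
theorem eventually_le_abs_of_isResonant {m : ℕ} {α : ℝ} (hα : Irrational α)
    {ζ : Fin m → UnitAddCircle} {θ : UnitAddCircle} (hθ : θ ∈ typicalPhases α ζ) {τ b ε : ℝ}
    (hτ : 0 < τ) (hb : τ * (ε / 10) < τ * b - ε / 4) (hε : 0 < ε) :
    ∀ᶠ n in atTop, IsResonant α τ b ε n → ∃ q : ℕ, cfDen α n = q ∧ 0 < q ∧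
      (∀ k : ℤ, k ≠ 0 → |k| < q → ∀ l : ℤ, 1 / (2 * (q : ℝ)) ≤ |k * α - l|) ∧
      ∀ k : ℤ, |(k : ℝ)| ≤ Real.exp (ε * q / 10) → ∀ ℓ, ∃ y : ℝ,
        (y : UnitAddCircle) = θ + k • (α : UnitAddCircle) - ζ ℓ ∧
          ∀ j < q, ∀ l : ℤ, 1 / (2 * (q : ℝ) ^ 3) ≤ |y + j * α - l| := by
  obtain ⟨q₀, hq₀⟩ := eventually_atTop.1 (eventually_all.2 fun ℓ => (hθ ℓ).2)
  -- Resonance gives `Q ≥ exp ((ε / 10 + γ) * q)`, and `γ > 0` is exactly the smallness condition on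
  -- `ε`. The surplus `exp (γ * q)` absorbs the polynomial factor `4 * q ^ 3`.
  set γ := (τ * b - ε / 4) / τ - ε / 10 with hγ
  have hγ0 : 0 < γ := by
    rw [hγ, sub_pos, lt_div_iff₀ hτ]; linarith
  have hexp : ∀ᶠ x : ℝ in atTop, x ^ 3 ≤ 1 / 4 * Real.exp (γ * x) := by
    filter_upwards [(isLittleO_pow_exp_pos_mul_atTop 3 hγ0).bound (show (0 : ℝ) < 1 / 4 by norm_num)]
      with x hx
    rw [Real.norm_eq_abs, Real.norm_of_nonneg (Real.exp_nonneg _)] at hx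
    exact (le_abs_self _).trans hx
  filter_upwards [(tendsto_cfDen hα).eventually hexp,
    (tendsto_cfDen hα).eventually_ge_atTop (q₀ : ℝ)] with n hn1 hn2 hres
  obtain ⟨q, p, hq, hq0, hcop, hp⟩ := exists_convergent hα n
  have hQ0 := cfDen_pos hα (n + 1)
  set Q := cfDen α (n + 1) with hQ
  have hq' : (1 : ℝ) ≤ q := by exact_mod_cast hq0
  rw [IsResonant, hq] at hres
  rw [hq] at hn1 hn2
  have hQexp : Real.exp ((ε / 10 + γ) * q) ≤ Q := by
    rw [← Real.le_log_iff_exp_le hQ0]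
    rw [lt_div_iff₀ (by positivity)] at hres
    have : (ε / 10 + γ) * q = ((τ * b - ε / 4) * q) / τ := by rw [hγ]; field_simp; ring
    rw [this, div_le_iff₀ hτ]
    linarith
  -- The shifts that occur are `k + j` with `|k| ≤ exp (ε * q / 10)` and `j < q`; this is the window
  -- condition for all of them.
  have hbig : 2 * (q : ℝ) ^ 2 * (Real.exp (ε * q / 10) + q) ≤ Q := by
    have he : 1 ≤ Real.exp (ε * q / 10) := Real.one_le_exp (by positivity)
    refine le_trans ?_ hQexp
    have hsplit : Real.exp ((ε / 10 + γ) * q) = Real.exp (ε * q / 10) * Real.exp (γ * q) := by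
      rw [← Real.exp_add]; congr 1; ring
    rw [hsplit]
    calc 2 * (q : ℝ) ^ 2 * (Real.exp (ε * q / 10) + q)
        ≤ 2 * (q : ℝ) ^ 2 * (Real.exp (ε * q / 10) * q + Real.exp (ε * q / 10) * q) := by
          gcongr
          · exact le_mul_of_one_le_right (Real.exp_nonneg _) hq'
          · exact le_mul_of_one_le_left (by positivity) he
      _ = Real.exp (ε * q / 10) * (4 * (q : ℝ) ^ 3) := by ring
      _ ≤ _ := by gcongr; linarith
  refine ⟨q, hq, hq0, ?_, ?_⟩
  · intro k hk0 hk l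
    refine le_abs_int_mul_sub hq0 hcop ?_ hp hk0 hk l
    have he := Real.exp_nonneg (ε * q / 10)
    have : (1 : ℝ) ≤ (q : ℝ) ^ 2 := one_le_pow₀ hq'
    nlinarith
  · intro k hk ℓ
    obtain ⟨t, ht⟩ := QuotientAddGroup.mk_surjective (θ - ζ ℓ)
    have ht' : (t : UnitAddCircle) = θ - ζ ℓ := ht
    refine ⟨t + k * α, ?_, fun j hj l => ?_⟩
    · rw [AddCircle.coe_add, ht', ← zsmul_eq_mul, AddCircle.coe_zsmul]; abel
    have h1 : 1 / (q : ℝ) ^ 2 ≤ ‖((q * t : ℝ) : UnitAddCircle)‖ := by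
      rw [← nsmul_eq_mul, AddCircle.coe_nsmul, ht']
      exact hq₀ q (by exact_mod_cast hn2) ℓ
    have h2 := le_abs_add_int_mul_sub hq0 hQ0 hp h1 (k := k + j) ?_ l
    · convert h2 using 2; push_cast; ring
    · refine le_trans ?_ hbig
      have hj' : (j : ℝ) ≤ q := by exact_mod_cast hj.le
      push_cast
      gcongr
      refine (abs_add_le _ _).trans ?_
      rw [Nat.abs_cast]
      exact add_le_add hk hj'

/-! ### Bounds near a fixed energy and infinitely many resonances -/

theorem eventually_add_log_lt (B C : ℝ) {ε : ℝ} (hε : 0 < ε) :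
    ∀ᶠ x : ℝ in atTop, B + C * max 0 (Real.log (2 * x ^ 3)) < ε * x := by
  have h1 : ∀ᶠ x : ℝ in atTop, |C| * 3 * Real.log x ≤ ε / 2 * x := by
    filter_upwards [Real.isLittleO_log_id_atTop.bound
      (show (0 : ℝ) < ε / (2 * (3 * |C| + 1)) by positivity), eventually_ge_atTop 1] with x hx hx1
    have hl := Real.log_nonneg hx1
    rw [Real.norm_of_nonneg hl, id, Real.norm_of_nonneg (by linarith), div_mul_eq_mul_div,
      le_div_iff₀ (by positivity)] at hx
    nlinarith [abs_nonneg C]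
  filter_upwards [h1, eventually_ge_atTop 1,
    eventually_gt_atTop ((B + |C| * Real.log 2) / (ε / 2))] with x hx hx1 hx2
  rw [div_lt_iff₀ (by positivity)] at hx2
  have hx0 : (0 : ℝ) < x := by linarith
  have hl := Real.log_nonneg hx1
  have hl2 := Real.log_nonneg one_le_two
  have hlog : Real.log (2 * x ^ 3) = Real.log 2 + 3 * Real.log x := by
    rw [Real.log_mul two_ne_zero (by positivity), Real.log_pow]; norm_num
  rw [hlog, max_eq_right (by positivity)]
  have h2 : C * (Real.log 2 + 3 * Real.log x) ≤ |C| * (Real.log 2 + 3 * Real.log x) :=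
    mul_le_mul_of_nonneg_right (le_abs_self C) (by positivity)
  linarith

/-- The integral of `log |f|` cancels between the two bounds. The slack `2 * ε` consists of `ε / 2`
from each bound and `ε` for the constants and `2 * m * log (2 * q ^ 3)`. The exponent is taken at
`E₀` for all of `U`, which makes the threshold uniform there. -/
theorem exists_nhds_eventually_norm_iterate_lt {m : ℕ} {α : ℝ} (hα : Irrational α)
    {ζ : Fin m → UnitAddCircle} {σ : Fin m → ℝ≥0} (hσ : ∀ ℓ, σ ℓ ≤ 1) {f g : UnitAddCircle → ℝ}
    (hf : Continuous f) (hg : Continuous g) (hfac : HasZeroFactorization ζ σ f)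
    {θ : UnitAddCircle} (hθ : θ ∈ typicalPhases α ζ) {τ b ε : ℝ} (hτ : 0 < τ)
    (hb : τ * (ε / 10) < τ * b - ε / 4) (hε : 0 < ε) (E₀ : ℝ) :
    ∃ U ∈ 𝓝 E₀, ∀ᶠ n in atTop, IsResonant α τ b ε n → ∀ E ∈ U, ∀ r : ℕ, 1 ≤ r →
      (r : ℝ) ≤ cfDen α n → ∀ k : ℤ, |(k : ℝ)| ≤ Real.exp (ε * cfDen α n / 10) →
        ‖iterate α (transferMatrix f g E) r (θ + k • (α : UnitAddCircle))‖ <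
          Real.exp ((lyapunov α (transferMatrix f g E₀) + 2 * ε) * cfDen α n) := by
  have hf0 := hfac.ae_ne_zero
  have hlog := hfac.integrable_log_abs
  obtain ⟨B₁, hU⟩ := exists_norm_iterate_clearedMatrix_le hα hf hg hf0 hlog E₀
    (show 0 < ε / 2 by positivity)
  obtain ⟨B₂, hB₂⟩ := hfac.exists_sum_log_abs_ge hα hσ (show 0 < ε / 2 by positivity)
  refine ⟨_, hU, ?_⟩
  have hL := lyapunov_nonneg (α := α) hf hg hf0 hlog E₀
  set L := lyapunov α (transferMatrix f g E₀)
  set c := ∫ y : UnitAddCircle, Real.log |f y|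
  filter_upwards [eventually_le_abs_of_isResonant hα hθ hτ hb hε,
    (tendsto_cfDen hα).eventually (eventually_add_log_lt (B₁ + B₂) (m * 2) hε)]
    with n hn hlarge hres E hE r _ hrq k hk
  obtain ⟨q, hq, hq0, hsep, hlow⟩ := hn hres
  rw [hq] at hlarge hrq hk ⊢
  have hrq' : r ≤ q := by exact_mod_cast hrq
  have hq' : (0 : ℝ) < q := by exact_mod_cast hq0
  set x := θ + k • (α : UnitAddCircle) with hx
  have hκ : (0 : ℝ) < 1 / (2 * (q : ℝ) ^ 3) := by positivity
  have hsum := hB₂ q r _ x hq0 hrq' hκ hsep fun ℓ => by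
    obtain ⟨y, hy, h⟩ := hlow k hk ℓ
    exact ⟨y, hy, fun j hj => h j (by omega)⟩
  have hne : ∀ j < r, f (x + j • (α : UnitAddCircle)) ≠ 0 := fun j _ => by
    obtain ⟨F, -, ⟨d, hd, hF⟩, hfF⟩ := hfac
    refine (log_abs_eq_of_factorization hd hF hfF fun ℓ h0 => (hθ ℓ).1 (k + j) ?_).1
    rw [add_smul, natCast_zsmul, ← add_assoc]
    exact h0
  have h1 := log_norm_iterate_transferMatrix (g := g) (E := E) hne
  have h2 : Real.log ‖iterate α (clearedMatrix f g E) r x‖ ≤ r * (L + c + ε / 2) + B₁ := by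
    rw [Real.log_le_iff_le_exp (norm_iterate_clearedMatrix_pos hne)]
    exact hE r x
  have hA : 0 < ‖iterate α (transferMatrix f g E) r x‖ :=
    one_pos.trans_le (one_le_norm_iterate_transferMatrix α f g E r x)
  rw [← Real.log_lt_iff_lt_exp hA, h1]
  rw [one_div_one_div] at hsum
  -- Replacing `r` by `q` requires `L ≥ 0`.
  have h3 : (r : ℝ) * (L + ε / 2) ≤ q * (L + ε / 2) := by gcongr
  linarith

/-- Division by `τ` turns the threshold into `b - ε / (4 * τ)`, strictly below the limsup even when
`b = β(α)`. -/
theorem frequently_isResonant {α τ b ε : ℝ} (hτ : 0 < τ) (hε : 0 < ε)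
    (hb : (b : EReal) ≤ betaIndex α) : ∃ᶠ n in atTop, IsResonant α τ b ε n := by
  have hlt : ((b - ε / (4 * τ) : ℝ) : EReal) < betaIndex α := by
    refine lt_of_lt_of_le ?_ hb
    rw [EReal.coe_lt_coe_iff]
    have : 0 < ε / (4 * τ) := by positivity
    linarith
  refine (frequently_lt_of_lt_limsup (by isBoundedDefault) hlt).mono fun n hn => ?_
  rw [EReal.coe_lt_coe_iff] at hn
  rw [IsResonant, mul_div_assoc]
  calc τ * b - ε / 4 = τ * (b - ε / (4 * τ)) := by field_simp
    _ < _ := mul_lt_mul_of_pos_left hn hτ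

theorem tauMin_pos {m : ℕ} {τ : Fin (m + 1) → ℝ≥0} (hτ : ∀ ℓ, 0 < τ ℓ) : 0 < tauMin τ := by
  rw [tauMin, NNReal.coe_pos, Finset.lt_inf'_iff]
  exact fun ℓ _ => hτ ℓ

end UnboundedCocycle

end

theorem lemma4p2 (α : ℝ) (hα : Irrational α) (m : ℕ) (hm : 1 ≤ m) (ζ : Fin m → UnitAddCircle) :
    ∃ Θ : Set UnitAddCircle,
      (∀ᵐ θ : UnitAddCircle, θ ∈ Θ) ∧
      (∀ θ ∈ Θ, ∀ (k : ℤ) (ℓ : Fin m), θ + k • (α : UnitAddCircle) ≠ ζ ℓ) ∧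
      ∀ τ : Fin (m + 1) → ℝ≥0, (∀ ℓ, 0 < τ ℓ ∧ τ ℓ ≤ 1) →
      ∀ f g : UnitAddCircle → ℝ, MemHolder (τ 0) f → MemHolder (τ 0) g →
        UnboundedCocycle.HasZeroFactorization ζ (fun ℓ : Fin m => τ ℓ.succ) f →
        -- the Lyapunov exponents are well defined, and bounded above on compact sets
        (∀ E : ℝ,
          (∀ n : ℕ, Integrable (fun x : UnitAddCircle => Real.log
            ‖UnboundedCocycle.iterate α (UnboundedCocycle.transferMatrix f g E) n x‖)) ∧
          Tendsto (UnboundedCocycle.lyapunovAverage α (UnboundedCocycle.transferMatrix f g E))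
            atTop
            (𝓝 (UnboundedCocycle.lyapunov α (UnboundedCocycle.transferMatrix f g E)))) ∧
        (∀ I : Set ℝ, IsCompact I →
          BddAbove ((fun E : ℝ =>
            UnboundedCocycle.lyapunov α (UnboundedCocycle.transferMatrix f g E)) '' I)) ∧
        ∀ b ε : ℝ, (b : EReal) ≤ UnboundedCocycle.betaIndex α → 0 < ε →
          UnboundedCocycle.tauMin τ * (ε / 10) < UnboundedCocycle.tauMin τ * b - ε / 4 →
          -- the subsequence is infinite
          (∃ᶠ n : ℕ in atTop,
            UnboundedCocycle.IsResonant α (UnboundedCocycle.tauMin τ) b ε n) ∧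
          -- the bound for a single energy
          (∀ θ ∈ Θ, ∀ E : ℝ, ∀ᶠ n : ℕ in atTop,
            UnboundedCocycle.IsResonant α (UnboundedCocycle.tauMin τ) b ε n →
            ∀ r : ℕ, 1 ≤ r → (r : ℝ) ≤ UnboundedCocycle.cfDen α n →
            ∀ k : ℤ, |(k : ℝ)| ≤ Real.exp (ε * UnboundedCocycle.cfDen α n / 10) →
              ‖UnboundedCocycle.iterate α (UnboundedCocycle.transferMatrix f g E) r
                  (θ + k • (α : UnitAddCircle))‖ <
                Real.exp ((UnboundedCocycle.lyapunov α
                  (UnboundedCocycle.transferMatrix f g E) + 2 * ε) *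
                    UnboundedCocycle.cfDen α n)) ∧
          -- the bound that is uniform in the energy on a compact set
          (∀ θ ∈ Θ, ∀ I : Set ℝ, IsCompact I → ∀ᶠ n : ℕ in atTop,
            UnboundedCocycle.IsResonant α (UnboundedCocycle.tauMin τ) b ε n →
            ∀ E ∈ I, ∀ r : ℕ, 1 ≤ r → (r : ℝ) ≤ UnboundedCocycle.cfDen α n →
            ∀ k : ℤ, |(k : ℝ)| ≤ Real.exp (ε * UnboundedCocycle.cfDen α n / 10) →
              ‖UnboundedCocycle.iterate α (UnboundedCocycle.transferMatrix f g E) r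
                  (θ + k • (α : UnitAddCircle))‖ <
                Real.exp ((2 * ε + sSup ((fun E' : ℝ => UnboundedCocycle.lyapunov α
                  (UnboundedCocycle.transferMatrix f g E')) '' I)) *
                    UnboundedCocycle.cfDen α n)) := by
  refine ⟨UnboundedCocycle.typicalPhases α ζ, UnboundedCocycle.ae_mem_typicalPhases α ζ,
    fun θ hθ k ℓ => (hθ ℓ).1 k, fun τ hτ f g hfH hgH hfac => ?_⟩
  have hf : Continuous f := hfH.holderWith.continuous (hτ 0).1
  have hg : Continuous g := hgH.holderWith.continuous (hτ 0).1
  have hf0 := hfac.ae_ne_zero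
  have hlog := hfac.integrable_log_abs
  refine ⟨fun E => ⟨fun n => UnboundedCocycle.integrable_log_norm_iterate hf hg hf0 hlog E n,
    UnboundedCocycle.tendsto_lyapunovAverage hf hg hf0 hlog E⟩,
    fun I hI => UnboundedCocycle.bddAbove_lyapunov_image hf hg hf0 hlog hI,
    fun b ε hbβ hε hb => ?_⟩
  have hτ0 := UnboundedCocycle.tauMin_pos fun ℓ => (hτ ℓ).1
  have hlocal := fun θ (hθ : θ ∈ UnboundedCocycle.typicalPhases α ζ) E =>
    UnboundedCocycle.exists_nhds_eventually_norm_iterate_lt hα (fun ℓ => (hτ ℓ.succ).2) hf hg hfac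
      hθ hτ0 hb hε E
  refine ⟨UnboundedCocycle.frequently_isResonant hτ0 hε hbβ, fun θ hθ E => ?_,
    fun θ hθ I hI => ?_⟩
  · obtain ⟨U, hU, h⟩ := hlocal θ hθ E
    exact h.mono fun n hn hres => hn hres E (mem_of_mem_nhds hU)
  · have hbdd := UnboundedCocycle.bddAbove_lyapunov_image (α := α) hf hg hf0 hlog hI
    set S := sSup ((fun E' : ℝ => UnboundedCocycle.lyapunov α
      (UnboundedCocycle.transferMatrix f g E')) '' I)
    -- The property passes to subsets and finite unions, so compactness reduces it to neighbourhoods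
    -- of points of `I`, where the exponent at the centre is at most `S`.
    refine hI.induction_on (p := fun J => ∀ᶠ n : ℕ in atTop,
      UnboundedCocycle.IsResonant α (UnboundedCocycle.tauMin τ) b ε n →
      ∀ E ∈ J, ∀ r : ℕ, 1 ≤ r → (r : ℝ) ≤ UnboundedCocycle.cfDen α n →
      ∀ k : ℤ, |(k : ℝ)| ≤ Real.exp (ε * UnboundedCocycle.cfDen α n / 10) →
        ‖UnboundedCocycle.iterate α (UnboundedCocycle.transferMatrix f g E) r
          (θ + k • (α : UnitAddCircle))‖ <
            Real.exp ((2 * ε + S) * UnboundedCocycle.cfDen α n)) ?_ ?_ ?_ ?_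
    · exact .of_forall fun n _ E hE => absurd hE (Set.notMem_empty E)
    · exact fun J J' hJ h => h.mono fun n hn hres E hE => hn hres E (hJ hE)
    · intro J J' h h'
      filter_upwards [h, h'] with n hn hn' hres E hE
      exact hE.elim (hn hres E) (hn' hres E)
    · intro E₀ hE₀
      obtain ⟨U, hU, h⟩ := hlocal θ hθ E₀
      refine ⟨U, mem_nhdsWithin_of_mem_nhds hU, h.mono fun n hn hres E hE r hr hrq k hk => ?_⟩
      refine (hn hres E hE r hr hrq k hk).trans_le (Real.exp_le_exp.2 ?_)
      have hle := le_csSup hbdd (Set.mem_image_of_mem _ hE₀)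
      exact mul_le_mul_of_nonneg_right (by linarith) (UnboundedCocycle.cfDen_pos hα n).le
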